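/- A (bivariate) copula is a function $C:[0,1]^2\to[0,1]$ with $C(u,0)=C(0,v)=0$, $C(u,1)=u$, $C(1,v)=v$ and $V_C([u_1,u_2]\times[v_1,v_2]):=C(u_2,v_2)-C(u_1,v_2)-C(u_2,v_1)+C(u_1,v_1)\ge 0$ for $u_1\le u_2$, $v_1\le v_2$. It is stochastically increasing if, for each $v$, the almost everywhere defined function $u\mapsto\partial_1C(u,v)$ is decreasing. For measurable $f:[0,1]\to\mathbb R$ let $f^*(t)=\inf\{x\in\mathbb R : \lambda(\{u\in[0,1]: f(u)>x\})\le t\}$ be its decreasing rearrangement, $\lambda$ being Lebesgue measure. The rearrangement $C^\uparrow(u,v)=\int_0^u(\partial_1C(\cdot,v))^*(s)\,ds$ of a copula $C$ is again a copula. For a real-valued function $\mu$ on the set of copulas put $R_\mu(C)=\mu(C^\uparrow)$. For a matrix $A=(a_{k\ell})\in\mathbb R^{N_1\times N_2}$ let $$C^\#_{N_1,N_2}(A)(u,v)=\sum_{k=1}^{N_1}\sum_{\ell=1}^{N_2}a_{k\ell}\int_0^u \mathbf 1_{[\frac{k-1}{N_1},\frac k{N_1})}(s)\,ds\int_0^v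 \mathbf 1_{[\frac{\ell-1}{N_2},\frac \ell{N_2})}(t)\,dt ,$$ and for a copula $C$ let $C^\#_{N_1,N_2}(C)=C^\#_{N_1,N_2}(A)$ with $a_{k\ell}=N_1N_2\,V_C\big([\tfrac{k-1}{N_1},\tfrac k{N_1}]\times[\tfrac{\ell-1}{N_2},\tfrac \ell{N_2}]\big)$. Given observations $(X_1,Y_1),\dots,(X_n,Y_n)$ without ties, let $\hat A_n$ be the $n\times n$ permutation matrix whose $(i,j)$ entry is $1$ if $\operatorname{rank}(X_k)=i$ and $\operatorname{rank}(Y_k)=j$ for some $k$, and $0$ otherwise; the empirical checkerboard copula is $\hat C^\#_{N_1,N_2,n}=C^\#_{N_1,N_2}\big(C^\#_{n,n}(n\hat A_n)\big)$. **Theorem.** Let $\mu$ be a real-valued function on the set of copulas such that $\mu(C_n)\to\mu(C)$ whenever $C_n$ $(n\in\mathbb N)$ and $C$ are stochastically increasing copulas with $C_n\to C$ pointwise. Let $(X_1,Y_1),(X_2,Y_2),\dots$ be independent random vectors in $\mathbb R^2$ with the same continuous distribution function $F$, with marginals $F_X,F_Y$, and let $C$ be its copula, i.e. the copula with $C(F_X(x),F_Y(y))=F(x,y)$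 for all $x,y\in\mathbb R$. Let $s_1,s_2\in(0,1/2)$ and $N_1=\lfloor n^{s_1}\rfloor$, $N_2=\lfloor n^{s_2}\rfloor$. Then $$R_\mu\big(\hat C^\#_{N_1,N_2,n}\big)\longrightarrow R_\mu(C)\quad\text{almost surely as } n\to\infty .$$ (Almost surely there are no ties in the sample, so that the estimator is defined for all $n\ge1$; on the exceptional null set, where $\hat C^\#_{N_1,N_2,n}$ need not be a copula, its value is immaterial.) -/

import Mathlib

open MeasureTheory ProbabilityTheory Set Filter Topology

/-- Signed volume `V_C([u₁,u₂] × [v₁,v₂])` of a rectangle under a function `C` on the unit square.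
For a copula `C` it is the mass that the measure induced by `C` gives to that rectangle
(boundary lines of the rectangle carry no mass). -/
def rectVolume (C : unitInterval → unitInterval → ℝ) (u₁ u₂ v₁ v₂ : unitInterval) : ℝ :=
  C u₂ v₂ - C u₁ v₂ - C u₂ v₁ + C u₁ v₁

/-- Bivariate copulas: grounded, with uniform margins, and 2-increasing. -/
structure IsCopula (C : unitInterval → unitInterval → ℝ) : Prop where
  zero_left : ∀ v, C 0 v = 0
  zero_right : ∀ u, C u 0 = 0
  one_left : ∀ v, C 1 v = v
  one_right : ∀ u, C u 1 = u
  two_increasing : ∀ u₁ u₂ v₁ v₂, u₁ ≤ u₂ → v₁ ≤ v₂ → 0 ≤ rectVolume C u₁ u₂ v₁ v₂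

/-- The set of all (bivariate) copulas. -/
abbrev Copula := {C : unitInterval → unitInterval → ℝ // IsCopula C}

/-- The section `u ↦ C(u, v)`, extended to the real line by its boundary values. -/
noncomputable def copulaSection (C : unitInterval → unitInterval → ℝ) (v : unitInterval) (u : ℝ) :
    ℝ :=
  C (projIcc 0 1 zero_le_one u) v

/-- The partial derivative `u ↦ ∂₁C(u, v)`, for a copula defined at almost every `u ∈ [0,1]`
(the value at the exceptional points is irrelevant below). -/
noncomputable def partialOne (C : unitInterval → unitInterval → ℝ) (v : unitInterval) (u : ℝ) : ℝ :=
  deriv (copulaSection C v) u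

/-- A copula is stochastically increasing if `u ↦ ∂₁C(u, v)` is decreasing for each `v`
(on the set of full measure on which the partial derivative exists). -/
def IsStochasticallyIncreasing (C : Copula) : Prop :=
  ∀ v, AntitoneOn (partialOne C.1 v)
    {u | u ∈ Ioo (0 : ℝ) 1 ∧ DifferentiableAt ℝ (copulaSection C.1 v) u}

/-- Decreasing rearrangement `f^*(t) = inf {x | λ{u ∈ [0,1] | f(u) > x} ≤ t}` of `f` on `[0,1]`. -/
noncomputable def decreasingRearrangement (f : ℝ → ℝ) (t : ℝ) : ℝ :=
  sInf {x : ℝ | volume {u : ℝ | u ∈ Icc (0 : ℝ) 1 ∧ x < f u} ≤ ENNReal.ofReal t}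

/-- The function `C^↑(u,v) = ∫₀ᵘ (∂₁C)^*(s, v) ds`, the rearrangement being applied in the first
coordinate. -/
noncomputable def siRearrangementFun (C : unitInterval → unitInterval → ℝ)
    (u v : unitInterval) : ℝ :=
  ∫ s in (0 : ℝ)..u, decreasingRearrangement (partialOne C v) s

section Rearrangement

theorem volume_superlevel_le_one (f : ℝ → ℝ) (x : ℝ) :
    volume {u : ℝ | u ∈ Icc (0 : ℝ) 1 ∧ x < f u} ≤ 1 := by
  calc volume {u : ℝ | u ∈ Icc (0 : ℝ) 1 ∧ x < f u} ≤ volume (Icc (0 : ℝ) 1) :=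
        measure_mono fun u hu => hu.1
    _ = 1 := by simp

theorem volume_superlevel_eq_one {f : ℝ → ℝ} (h0 : ∀ u, 0 ≤ f u) {x : ℝ} (hx : x < 0) :
    volume {u : ℝ | u ∈ Icc (0 : ℝ) 1 ∧ x < f u} = 1 := by
  have : {u : ℝ | u ∈ Icc (0 : ℝ) 1 ∧ x < f u} = Icc 0 1 := by
    ext u
    exact ⟨fun h => h.1, fun h => ⟨h, hx.trans_le (h0 u)⟩⟩
  rw [this]; simp

theorem lt_decreasingRearrangement_iff {f : ℝ → ℝ} (h0 : ∀ u, 0 ≤ f u) (h1 : ∀ u, f u ≤ 1)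
    {t : ℝ} (ht : t < 1) (x : ℝ) :
    x < decreasingRearrangement f t ↔
      ENNReal.ofReal t < volume {u : ℝ | u ∈ Icc (0 : ℝ) 1 ∧ x < f u} := by
  set S : Set ℝ := {x : ℝ | volume {u : ℝ | u ∈ Icc (0 : ℝ) 1 ∧ x < f u} ≤ ENNReal.ofReal t}
    with hS
  have hup : ∀ a ∈ S, ∀ b, a ≤ b → b ∈ S := fun a ha b hab =>
    le_trans (measure_mono fun u (hu : u ∈ Icc (0 : ℝ) 1 ∧ b < f u) =>
      (⟨hu.1, hab.trans_lt hu.2⟩ : u ∈ Icc (0 : ℝ) 1 ∧ a < f u)) ha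
  have hne : S.Nonempty := by
    refine ⟨1, ?_⟩
    have : {u : ℝ | u ∈ Icc (0 : ℝ) 1 ∧ 1 < f u} = ∅ := by
      ext u; simpa using fun _ _ => h1 u
    change volume {u : ℝ | u ∈ Icc (0 : ℝ) 1 ∧ 1 < f u} ≤ _
    rw [this, measure_empty]
    exact bot_le
  have hbdd : BddBelow S := by
    refine ⟨0, fun a ha => ?_⟩
    by_contra! hlt
    have h2 : volume {u : ℝ | u ∈ Icc (0 : ℝ) 1 ∧ a < f u} ≤ ENNReal.ofReal t := ha
    rw [volume_superlevel_eq_one h0 hlt] at h2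
    exact absurd h2 (not_le.2 (by simpa using ht))
  have hmem : sInf S ∈ S := by
    have hU : {u : ℝ | u ∈ Icc (0 : ℝ) 1 ∧ sInf S < f u} =
        ⋃ n : ℕ, {u : ℝ | u ∈ Icc (0 : ℝ) 1 ∧ sInf S + 1 / ((n : ℝ) + 1) < f u} := by
      ext u
      simp only [mem_ofPred_eq, mem_iUnion]
      constructor
      · rintro ⟨hu, hlt⟩
        obtain ⟨n, hn⟩ := exists_nat_one_div_lt (sub_pos.2 hlt)
        exact ⟨n, hu, by linarith⟩
      · rintro ⟨n, hu, hlt⟩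
        have : (0 : ℝ) < 1 / ((n : ℝ) + 1) := by positivity
        exact ⟨hu, by linarith⟩
    have hmono : Monotone fun n : ℕ =>
        {u : ℝ | u ∈ Icc (0 : ℝ) 1 ∧ sInf S + 1 / ((n : ℝ) + 1) < f u} := by
      intro n m hnm u hu
      have : 1 / ((m : ℝ) + 1) ≤ 1 / ((n : ℝ) + 1) := by gcongr
      have h3 := hu.2
      exact ⟨hu.1, by linarith⟩
    change volume _ ≤ _
    rw [hU, hmono.measure_iUnion]
    refine iSup_le fun n => ?_
    have hpos : sInf S < sInf S + 1 / ((n : ℝ) + 1) := by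
      have : (0 : ℝ) < 1 / ((n : ℝ) + 1) := by positivity
      linarith
    obtain ⟨a, ha, hlt⟩ := exists_lt_of_csInf_lt hne hpos
    exact hup a ha _ hlt.le
  change x < sInf S ↔ _
  rw [← not_le, ← not_le, not_iff_not]
  exact ⟨fun h => hup _ hmem _ h, fun h => csInf_le hbdd h⟩

theorem decreasingRearrangement_nonneg {f : ℝ → ℝ} (h0 : ∀ u, 0 ≤ f u) (h1 : ∀ u, f u ≤ 1)
    {t : ℝ} (ht : t < 1) : 0 ≤ decreasingRearrangement f t := by
  refine le_of_forall_lt fun x hx => ?_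
  rw [lt_decreasingRearrangement_iff h0 h1 ht, volume_superlevel_eq_one h0 hx]
  simpa using ht

theorem decreasingRearrangement_le_one {f : ℝ → ℝ} (h0 : ∀ u, 0 ≤ f u) (h1 : ∀ u, f u ≤ 1)
    {t : ℝ} (ht : t < 1) : decreasingRearrangement f t ≤ 1 := by
  by_contra! h
  rw [lt_decreasingRearrangement_iff h0 h1 ht] at h
  have : {u : ℝ | u ∈ Icc (0 : ℝ) 1 ∧ 1 < f u} = ∅ := by
    ext u; simpa using fun _ _ => h1 u
  rw [this, measure_empty] at h
  exact absurd h not_lt_bot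

theorem decreasingRearrangement_mono {f g : ℝ → ℝ} (hf0 : ∀ u, 0 ≤ f u) (hf1 : ∀ u, f u ≤ 1)
    (hg0 : ∀ u, 0 ≤ g u) (hg1 : ∀ u, g u ≤ 1)
    (hfg : ∀ᵐ u ∂(volume.restrict (Icc (0 : ℝ) 1)), f u ≤ g u) {t : ℝ} (ht : t < 1) :
    decreasingRearrangement f t ≤ decreasingRearrangement g t := by
  refine le_of_forall_lt fun x hx => ?_
  rw [lt_decreasingRearrangement_iff hf0 hf1 ht] at hx
  rw [lt_decreasingRearrangement_iff hg0 hg1 ht]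
  refine hx.trans_le (measure_mono_ae ?_)
  rw [ae_restrict_iff' measurableSet_Icc] at hfg
  filter_upwards [hfg] with u hu h
  exact ⟨h.1, h.2.trans_le (hu h.1)⟩

theorem decreasingRearrangement_antitoneOn {f : ℝ → ℝ} (h0 : ∀ u, 0 ≤ f u)
    (h1 : ∀ u, f u ≤ 1) : AntitoneOn (decreasingRearrangement f) (Iio 1) := by
  intro s hs t ht hst
  refine le_of_forall_lt fun x hx => ?_
  rw [lt_decreasingRearrangement_iff h0 h1 ht] at hx
  rw [lt_decreasingRearrangement_iff h0 h1 hs]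
  exact (ENNReal.ofReal_le_ofReal hst).trans_lt hx

theorem integrableOn_decreasingRearrangement {f : ℝ → ℝ} (h0 : ∀ u, 0 ≤ f u)
    (h1 : ∀ u, f u ≤ 1) : IntegrableOn (decreasingRearrangement f) (Ico 0 1) := by
  have hm : AEMeasurable (decreasingRearrangement f) (volume.restrict (Ico 0 1)) :=
    aemeasurable_restrict_of_antitoneOn measurableSet_Ico
      ((decreasingRearrangement_antitoneOn h0 h1).mono fun x hx => hx.2)
  refine Integrable.of_bound hm.aestronglyMeasurable 1 ?_
  filter_upwards [ae_restrict_mem measurableSet_Ico] with t ht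
  rw [Real.norm_eq_abs, abs_of_nonneg (decreasingRearrangement_nonneg h0 h1 ht.2)]
  exact decreasingRearrangement_le_one h0 h1 ht.2

theorem intervalIntegrable_decreasingRearrangement {f : ℝ → ℝ} (h0 : ∀ u, 0 ≤ f u)
    (h1 : ∀ u, f u ≤ 1) {a b : ℝ} (ha : a ∈ Icc (0 : ℝ) 1) (hb : b ∈ Icc (0 : ℝ) 1) :
    IntervalIntegrable (decreasingRearrangement f) volume a b := by
  have h : IntervalIntegrable (decreasingRearrangement f) volume 0 1 :=
    (intervalIntegrable_iff_integrableOn_Ico_of_le zero_le_one).2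
      (integrableOn_decreasingRearrangement h0 h1)
  refine h.mono_set ?_
  rw [uIcc_of_le (zero_le_one' ℝ)]
  exact uIcc_subset_Icc ha hb

theorem integral_decreasingRearrangement {f : ℝ → ℝ} (hf : Measurable f) (h0 : ∀ u, 0 ≤ f u)
    (h1 : ∀ u, f u ≤ 1) :
    ∫ s in (0 : ℝ)..1, decreasingRearrangement f s = ∫ s in (0 : ℝ)..1, f s := by
  have hfi : IntegrableOn f (Ico 0 1) := by
    refine Integrable.of_bound hf.aestronglyMeasurable 1 (ae_of_all _ fun t => ?_)
    rw [Real.norm_eq_abs, abs_of_nonneg (h0 t)]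
    exact h1 t
  have hnn : 0 ≤ᵐ[volume.restrict (Ico 0 1)] decreasingRearrangement f := by
    filter_upwards [ae_restrict_mem measurableSet_Ico] with t ht
    exact decreasingRearrangement_nonneg h0 h1 ht.2
  rw [intervalIntegral.integral_of_le zero_le_one, intervalIntegral.integral_of_le zero_le_one,
    ← integral_Ico_eq_integral_Ioc, ← integral_Ico_eq_integral_Ioc,
    (integrableOn_decreasingRearrangement h0 h1).integral_eq_integral_meas_lt hnn,
    Integrable.integral_eq_integral_meas_lt hfi (ae_of_all _ h0)]
  refine integral_congr_ae (ae_of_all _ fun x => ?_)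
  simp only [measureReal_def]
  congr 1
  rw [Measure.restrict_apply' measurableSet_Ico, Measure.restrict_apply' measurableSet_Ico]
  set m := volume {u : ℝ | u ∈ Icc (0 : ℝ) 1 ∧ x < f u} with hm
  have hm1 : m ≤ 1 := volume_superlevel_le_one f x
  have hmt : m ≠ ⊤ := (hm1.trans_lt ENNReal.one_lt_top).ne
  have hm1' : m.toReal ≤ 1 := by
    simpa using ENNReal.toReal_mono ENNReal.one_ne_top hm1
  have e1 : {a | x < decreasingRearrangement f a} ∩ Ico 0 1 = Ico 0 m.toReal := by
    ext t
    simp only [mem_inter_iff, mem_ofPred_eq, mem_Ico]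
    constructor
    · rintro ⟨h, h2, h3⟩
      rw [lt_decreasingRearrangement_iff h0 h1 h3] at h
      exact ⟨h2, (ENNReal.ofReal_lt_iff_lt_toReal h2 hmt).1 h⟩
    · rintro ⟨h2, h3⟩
      have h4 : t < 1 := h3.trans_le hm1'
      refine ⟨?_, h2, h4⟩
      rw [lt_decreasingRearrangement_iff h0 h1 h4]
      exact (ENNReal.ofReal_lt_iff_lt_toReal h2 hmt).2 h3
  rw [e1, Real.volume_Ico, sub_zero, ENNReal.ofReal_toReal hmt, hm]
  refine measure_congr ?_
  have hae : ∀ᵐ u : ℝ, u ≠ 1 := by simp [ae_iff]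
  filter_upwards [hae] with u hu
  refine propext ?_
  change (u ∈ Icc (0 : ℝ) 1 ∧ x < f u) ↔ (x < f u ∧ u ∈ Ico (0 : ℝ) 1)
  simp only [mem_Icc, mem_Ico]
  constructor
  · rintro ⟨⟨a, b⟩, c⟩
    exact ⟨c, a, lt_of_le_of_ne b hu⟩
  · rintro ⟨c, a, b⟩
    exact ⟨⟨a, b.le⟩, c⟩

end Rearrangement

section SIRearrangement

theorem IsCopula.copulaSection_sub_nonneg {C : unitInterval → unitInterval → ℝ} (hC : IsCopula C)
    {v₁ v₂ : unitInterval} (hv : v₁ ≤ v₂) :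
    Monotone fun u => copulaSection C v₂ u - copulaSection C v₁ u := by
  intro a b hab
  have h := hC.two_increasing _ _ v₁ v₂ (monotone_projIcc (zero_le_one' ℝ) hab) hv
  simp only [rectVolume] at h
  simp only [copulaSection]
  linarith

theorem IsCopula.monotone_copulaSection {C : unitInterval → unitInterval → ℝ} (hC : IsCopula C)
    (v : unitInterval) : Monotone (copulaSection C v) := by
  have h := hC.copulaSection_sub_nonneg (v₁ := 0) (v₂ := v) v.2.1
  intro a b hab
  have h2 := h hab
  simpa [copulaSection, hC.zero_right] using h2

theorem IsCopula.lipschitzWith_copulaSection {C : unitInterval → unitInterval → ℝ}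
    (hC : IsCopula C) (v : unitInterval) : LipschitzWith 1 (copulaSection C v) := by
  refine LipschitzWith.of_le_add fun a b => ?_
  rcases le_total a b with hab | hab
  · have := hC.monotone_copulaSection v hab
    have := dist_nonneg (x := a) (y := b)
    linarith
  · have h := hC.copulaSection_sub_nonneg (v₁ := v) (v₂ := 1) unitInterval.le_one' hab
    simp only [copulaSection, hC.one_right] at h
    have h2 : dist (projIcc 0 1 (zero_le_one' ℝ) a) (projIcc 0 1 (zero_le_one' ℝ) b) ≤ dist a b := by
      simpa using (LipschitzWith.projIcc (zero_le_one' ℝ)).dist_le_mul a b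
    rw [Subtype.dist_eq, Real.dist_eq] at h2
    have h3 := le_abs_self
      ((projIcc 0 1 (zero_le_one' ℝ) a : ℝ) - (projIcc 0 1 (zero_le_one' ℝ) b : ℝ))
    simp only [copulaSection]
    linarith

theorem IsCopula.partialOne_nonneg {C : unitInterval → unitInterval → ℝ} (hC : IsCopula C)
    (v : unitInterval) (u : ℝ) : 0 ≤ partialOne C v u :=
  (hC.monotone_copulaSection v).deriv_nonneg

theorem IsCopula.partialOne_le_one {C : unitInterval → unitInterval → ℝ} (hC : IsCopula C)
    (v : unitInterval) (u : ℝ) : partialOne C v u ≤ 1 := by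
  have h := norm_deriv_le_of_lipschitz (x₀ := u) (hC.lipschitzWith_copulaSection v)
  rw [NNReal.coe_one, Real.norm_eq_abs] at h
  exact (le_abs_self _).trans h

theorem IsCopula.ae_differentiableAt {C : unitInterval → unitInterval → ℝ} (hC : IsCopula C)
    (v : unitInterval) : ∀ᵐ u : ℝ, DifferentiableAt ℝ (copulaSection C v) u :=
  (hC.lipschitzWith_copulaSection v).ae_differentiableAt

theorem IsCopula.ae_partialOne_mono {C : unitInterval → unitInterval → ℝ} (hC : IsCopula C)
    {v₁ v₂ : unitInterval} (hv : v₁ ≤ v₂) : ∀ᵐ u : ℝ, partialOne C v₁ u ≤ partialOne C v₂ u := by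
  filter_upwards [hC.ae_differentiableAt v₁, hC.ae_differentiableAt v₂] with u h1 h2
  have h := (hC.copulaSection_sub_nonneg hv).deriv_nonneg (x := u)
  rw [deriv_fun_sub h2 h1] at h
  simp only [partialOne]
  linarith

theorem IsCopula.integral_partialOne {C : unitInterval → unitInterval → ℝ} (hC : IsCopula C)
    (v : unitInterval) : ∫ u in (0 : ℝ)..1, partialOne C v u = v := by
  have h : AbsolutelyContinuousOnInterval (copulaSection C v) 0 1 :=
    ((hC.lipschitzWith_copulaSection v).lipschitzOnWith).absolutelyContinuousOnInterval
  have h2 := h.integral_deriv_eq_sub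
  have e1 : copulaSection C v 1 = v := by simp [copulaSection, hC.one_left]
  have e0 : copulaSection C v 0 = 0 := by simp [copulaSection, hC.zero_left]
  simp only [partialOne]
  rw [h2, e1, e0, sub_zero]

theorem IsCopula.decreasingRearrangement_one {C : unitInterval → unitInterval → ℝ}
    (hC : IsCopula C) {t : ℝ} (ht : t ∈ Ico (0 : ℝ) 1) :
    decreasingRearrangement (partialOne C 1) t = 1 := by
  refine le_antisymm (decreasingRearrangement_le_one (hC.partialOne_nonneg 1)
    (hC.partialOne_le_one 1) ht.2) (le_of_forall_lt fun x hx => ?_)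
  rw [lt_decreasingRearrangement_iff (hC.partialOne_nonneg 1) (hC.partialOne_le_one 1) ht.2]
  have hsub : Ioo (0 : ℝ) 1 ⊆ {u : ℝ | u ∈ Icc (0 : ℝ) 1 ∧ x < partialOne C 1 u} := by
    intro u hu
    refine ⟨Ioo_subset_Icc_self hu, ?_⟩
    have hev : copulaSection C 1 =ᶠ[𝓝 u] fun y => y := by
      filter_upwards [Ioo_mem_nhds hu.1 hu.2] with y hy
      simp only [copulaSection, hC.one_right]
      rw [projIcc_of_mem (zero_le_one' ℝ) (Ioo_subset_Icc_self hy)]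
    rw [partialOne, hev.deriv_eq]
    simpa using hx
  calc ENNReal.ofReal t < 1 := by simpa using ht.2
    _ = volume (Ioo (0 : ℝ) 1) := by simp
    _ ≤ _ := measure_mono hsub

/-- The function `C^↑` is a copula. -/
theorem IsCopula.isCopula_siRearrangementFun {C : unitInterval → unitInterval → ℝ} (hC : IsCopula C) :
    IsCopula (siRearrangementFun C) where
  zero_left v := by simp [siRearrangementFun]
  zero_right u := by
    have h : partialOne C 0 = fun _ => 0 := by
      funext u
      have : copulaSection C 0 = fun _ => 0 := by
        funext y; simp [copulaSection, hC.zero_right]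
      simp [partialOne, this]
    have hu : ∀ s < (1 : ℝ), decreasingRearrangement (partialOne C 0) s = 0 := by
      intro s hs
      refine le_antisymm (le_of_not_gt fun hlt => ?_)
        (decreasingRearrangement_nonneg (hC.partialOne_nonneg 0) (hC.partialOne_le_one 0) hs)
      rw [lt_decreasingRearrangement_iff (hC.partialOne_nonneg 0) (hC.partialOne_le_one 0) hs,
        h] at hlt
      simp at hlt
    rw [siRearrangementFun, intervalIntegral.integral_of_le u.2.1,
      ← integral_Ico_eq_integral_Ioc]
    exact setIntegral_eq_zero_of_forall_eq_zero fun s hs => hu s (hs.2.trans_le u.2.2)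
  one_left v := by
    have hm : Measurable (partialOne C v) := measurable_deriv _
    rw [siRearrangementFun]
    simp only [Icc.coe_one]
    rw [integral_decreasingRearrangement hm (hC.partialOne_nonneg v) (hC.partialOne_le_one v),
      hC.integral_partialOne]
  one_right u := by
    rw [siRearrangementFun, intervalIntegral.integral_of_le u.2.1,
      ← integral_Ico_eq_integral_Ioc,
      setIntegral_congr_fun (g := fun _ => (1 : ℝ)) measurableSet_Ico
        fun s hs => hC.decreasingRearrangement_one ⟨hs.1, hs.2.trans_le u.2.2⟩]
    simp [u.2.1]
  two_increasing u₁ u₂ v₁ v₂ hu hv := by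
    have key : ∀ v, siRearrangementFun C u₂ v - siRearrangementFun C u₁ v =
        ∫ s in (u₁ : ℝ)..u₂, decreasingRearrangement (partialOne C v) s := fun v =>
      intervalIntegral.integral_interval_sub_left
        (intervalIntegrable_decreasingRearrangement (hC.partialOne_nonneg v)
          (hC.partialOne_le_one v) (by simp) u₂.2)
        (intervalIntegrable_decreasingRearrangement (hC.partialOne_nonneg v)
          (hC.partialOne_le_one v) (by simp) u₁.2)
    have hle : ∫ s in (u₁ : ℝ)..u₂, decreasingRearrangement (partialOne C v₁) s ≤
        ∫ s in (u₁ : ℝ)..u₂, decreasingRearrangement (partialOne C v₂) s := by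
      refine intervalIntegral.integral_mono_on_of_le_Ioo hu
        (intervalIntegrable_decreasingRearrangement (hC.partialOne_nonneg v₁)
          (hC.partialOne_le_one v₁) u₁.2 u₂.2)
        (intervalIntegrable_decreasingRearrangement (hC.partialOne_nonneg v₂)
          (hC.partialOne_le_one v₂) u₁.2 u₂.2) fun s hs => ?_
      exact decreasingRearrangement_mono (hC.partialOne_nonneg v₁) (hC.partialOne_le_one v₁)
        (hC.partialOne_nonneg v₂) (hC.partialOne_le_one v₂)
        (ae_restrict_of_ae (hC.ae_partialOne_mono hv)) (hs.2.trans_le u₂.2.2)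
    have k1 := key v₁
    have k2 := key v₂
    simp only [rectVolume]
    linarith

end SIRearrangement

/-- The stochastically increasing rearrangement `C^↑` of a copula `C`. -/
noncomputable def siRearrangement (C : Copula) : Copula :=
  ⟨siRearrangementFun C.1, C.2.isCopula_siRearrangementFun⟩

/-- The rearranged dependence measure `R_μ(C) = μ(C^↑)`. -/
noncomputable def rearrangedMeasure (μ : Copula → ℝ) (C : Copula) : ℝ :=
  μ (siRearrangement C)

/-- Continuity of `μ` on the stochastically increasing copulas with respect to pointwise
convergence. -/
def ContinuousOnStochasticallyIncreasing (μ : Copula → ℝ) : Prop :=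
  ∀ (D : ℕ → Copula) (C : Copula), (∀ n, IsStochasticallyIncreasing (D n)) →
    IsStochasticallyIncreasing C →
    (∀ u v, Tendsto (fun n => (D n).1 u v) atTop (𝓝 (C.1 u v))) →
    Tendsto (fun n => μ (D n)) atTop (𝓝 (μ C))

/-- The checkerboard function of a matrix `A`; with zero-based indices the cells are
`[k/N₁, (k+1)/N₁) × [ℓ/N₂, (ℓ+1)/N₂)`. -/
noncomputable def checkerboard {N₁ N₂ : ℕ} (A : Matrix (Fin N₁) (Fin N₂) ℝ)
    (u v : unitInterval) : ℝ :=
  ∑ k : Fin N₁, ∑ l : Fin N₂, A k l *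
    (∫ s in (0 : ℝ)..u, (Ico ((k : ℝ) / N₁) (((k : ℝ) + 1) / N₁)).indicator (fun _ => (1 : ℝ)) s) *
    (∫ t in (0 : ℝ)..v, (Ico ((l : ℝ) / N₂) (((l : ℝ) + 1) / N₂)).indicator (fun _ => (1 : ℝ)) t)

/-- The grid point `k / N` of the unit interval. -/
noncomputable def gridPoint {N : ℕ} (k : Fin (N + 1)) : unitInterval :=
  ⟨(k : ℝ) / N, unitInterval.div_mem (Nat.cast_nonneg _) (Nat.cast_nonneg _)
    (Nat.cast_le.2 (Nat.lt_succ_iff.1 k.2))⟩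

/-- The weights `N₁ N₂ V_C(cell)` of the induced `N₁ × N₂` checkerboard copula of `C`. -/
noncomputable def inducedMatrix (N₁ N₂ : ℕ) (C : unitInterval → unitInterval → ℝ) :
    Matrix (Fin N₁) (Fin N₂) ℝ :=
  Matrix.of fun k l => (N₁ : ℝ) * N₂ *
    rectVolume C (gridPoint k.castSucc) (gridPoint k.succ) (gridPoint l.castSucc) (gridPoint l.succ)

/-- The rank of `x k` among `x 0, …, x (n-1)` (a number in `{1, …, n}`). -/
noncomputable def sampleRank {n : ℕ} (x : Fin n → ℝ) (k : Fin n) : ℕ :=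
  {j : Fin n | x j ≤ x k}.ncard

open Classical in
/-- The rank matrix of a sample: the entry at (zero-based) position `(i, j)` is `1` if some
observation has ranks `(i+1, j+1)`, and `0` otherwise. -/
noncomputable def rankMatrix {n : ℕ} (x y : Fin n → ℝ) : Matrix (Fin n) (Fin n) ℝ :=
  Matrix.of fun i j =>
    if ∃ k, sampleRank x k = (i : ℕ) + 1 ∧ sampleRank y k = (j : ℕ) + 1 then 1 else 0

/-- The empirical checkerboard copula with bandwidths `N₁, N₂`: the induced `N₁ × N₂` checkerboard
of the `n × n` checkerboard of the rank matrix. In the normalisation of `checkerboard` the rows and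
columns of an `n × n` weight matrix sum to `n`, so the permutation matrix carries the factor `n`. -/
noncomputable def empiricalCheckerboard {n : ℕ} (N₁ N₂ : ℕ) (x y : Fin n → ℝ) :
    unitInterval → unitInterval → ℝ :=
  checkerboard (inducedMatrix N₁ N₂ (checkerboard ((n : ℝ) • rankMatrix x y)))

section CheckerboardFacts

/-- The constraints on the weight matrix of a checkerboard copula. -/
structure IsCheckerboardMatrix {N₁ N₂ : ℕ} (A : Matrix (Fin N₁) (Fin N₂) ℝ) : Prop where
  nonneg : ∀ k l, 0 ≤ A k l
  sum_col : ∀ l, ∑ k, A k l = N₁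
  sum_row : ∀ k, ∑ l, A k l = N₂

theorem cell_integral {a b u : ℝ} (ha : 0 ≤ a) (hab : a ≤ b) (hu : 0 ≤ u) :
    ∫ s in (0 : ℝ)..u, (Ico a b).indicator (fun _ => (1 : ℝ)) s = min u b - min u a := by
  rw [intervalIntegral.integral_of_le hu, ← integral_Ico_eq_integral_Ioc,
    setIntegral_indicator measurableSet_Ico, Ico_inter_Ico]
  simp only [integral_const, MeasurableSet.univ, measureReal_restrict_apply, univ_inter,
    Real.volume_real_Ico, smul_eq_mul, mul_one]
  rcases le_total u a with h | h <;> rcases le_total u b with h' | h' <;>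
    simp [*] <;> linarith

theorem sum_succ_sub {N : ℕ} (g : Fin (N + 1) → ℝ) :
    ∑ k : Fin N, (g k.succ - g k.castSucc) = g (Fin.last N) - g 0 := by
  have h1 := Fin.sum_univ_succ g
  have h2 := Fin.sum_univ_castSucc g
  rw [Finset.sum_sub_distrib]
  linarith

theorem isCopula_checkerboard {N₁ N₂ : ℕ} (h₁ : 0 < N₁) (h₂ : 0 < N₂)
    {A : Matrix (Fin N₁) (Fin N₂) ℝ} (hA : IsCheckerboardMatrix A) : IsCopula (checkerboard A) := by
  have cell : ∀ (N : ℕ) (k : Fin N) (u : unitInterval),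
      ∫ s in (0 : ℝ)..u, (Ico ((k : ℝ) / N) (((k : ℝ) + 1) / N)).indicator (fun _ => (1 : ℝ)) s
        = min (u : ℝ) (((k : ℝ) + 1) / N) - min (u : ℝ) ((k : ℝ) / N) := fun N k u =>
    cell_integral (by positivity) (by gcongr; linarith) u.2.1
  have cell0 : ∀ (N : ℕ) (k : Fin N),
      min ((0 : unitInterval) : ℝ) (((k : ℝ) + 1) / N) - min ((0 : unitInterval) : ℝ) ((k : ℝ) / N)
        = 0 := fun N k => by
    rw [min_eq_left (by simp; positivity), min_eq_left (by simp; positivity), sub_self]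
  have cell1 : ∀ (N : ℕ) (k : Fin N),
      min ((1 : unitInterval) : ℝ) (((k : ℝ) + 1) / N) - min ((1 : unitInterval) : ℝ) ((k : ℝ) / N)
        = 1 / N := fun N k => by
    have hN : (0 : ℝ) < N := Nat.cast_pos.2 k.pos
    have hk : (k : ℝ) + 1 ≤ N := by exact_mod_cast k.2
    rw [min_eq_right, min_eq_right]
    · ring
    · simp; rw [div_le_one hN]; linarith
    · simp; rwa [div_le_one hN]
  have cellmono : ∀ (N : ℕ) (k : Fin N) (u u' : unitInterval), u ≤ u' →
      min (u : ℝ) (((k : ℝ) + 1) / N) - min (u : ℝ) ((k : ℝ) / N) ≤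
      min (u' : ℝ) (((k : ℝ) + 1) / N) - min (u' : ℝ) ((k : ℝ) / N) := fun N k u u' h => by
    have h' : (u : ℝ) ≤ u' := h
    have h2 : (k : ℝ) / N ≤ ((k : ℝ) + 1) / N := by gcongr; linarith
    rcases le_total (u : ℝ) (((k : ℝ) + 1) / N) with h3 | h3 <;>
    rcases le_total (u : ℝ) (((k : ℝ)) / N) with h4 | h4 <;>
    rcases le_total (u' : ℝ) (((k : ℝ) + 1) / N) with h5 | h5 <;>
    rcases le_total (u' : ℝ) (((k : ℝ)) / N) with h6 | h6 <;>
    simp [*] <;> linarith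
  have cellsum : ∀ (N : ℕ) (_ : 0 < N) (u : unitInterval),
      ∑ k : Fin N, (min (u : ℝ) (((k : ℝ) + 1) / N) - min (u : ℝ) ((k : ℝ) / N)) = u :=
    fun N hN u => by
    have h := sum_succ_sub (fun k : Fin (N + 1) => min (u : ℝ) ((k : ℝ) / N))
    have hN' : (N : ℝ) ≠ 0 := by positivity
    simp only [Fin.val_succ, Fin.val_castSucc, Nat.cast_add, Nat.cast_one, Fin.val_last,
      Fin.val_zero, Nat.cast_zero, zero_div, div_self hN', min_eq_left u.2.2,
      min_eq_right u.2.1, sub_zero] at h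
    exact h
  have hN₁ : (N₁ : ℝ) ≠ 0 := by positivity
  have hN₂ : (N₂ : ℝ) ≠ 0 := by positivity
  constructor
  · intro v
    simp only [checkerboard, cell, cell0]
    simp
  · intro v
    simp only [checkerboard, cell, cell0]
    simp
  · intro v
    simp only [checkerboard, cell, cell1]
    rw [Finset.sum_comm]
    simp only [← Finset.sum_mul, hA.sum_col]
    rw [← Finset.mul_sum, cellsum _ h₂]
    field_simp
  · intro u
    simp only [checkerboard, cell, cell1, mul_right_comm, ← Finset.sum_mul, hA.sum_row]
    rw [← Finset.mul_sum, cellsum _ h₁]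
    field_simp
  · intro u₁ u₂ v₁ v₂ hu hv
    simp only [rectVolume, checkerboard, cell, ← Finset.sum_sub_distrib, ← Finset.sum_add_distrib]
    refine Finset.sum_nonneg fun k _ => Finset.sum_nonneg fun l _ => ?_
    have := mul_nonneg (mul_nonneg (hA.nonneg k l) (sub_nonneg.2 (cellmono _ k _ _ hu)))
      (sub_nonneg.2 (cellmono _ l _ _ hv))
    linarith

theorem IsCopula.isCheckerboardMatrix {N₁ N₂ : ℕ} (h₁ : 0 < N₁) (h₂ : 0 < N₂)
    {C : unitInterval → unitInterval → ℝ} (hC : IsCopula C) :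
    IsCheckerboardMatrix (inducedMatrix N₁ N₂ C) := by
  have hN₁ : (N₁ : ℝ) ≠ 0 := by positivity
  have hN₂ : (N₂ : ℝ) ≠ 0 := by positivity
  have gm : ∀ (N : ℕ) (k : Fin N), gridPoint k.castSucc ≤ gridPoint k.succ := fun N k => by
    change ((k.castSucc : Fin _) : ℝ) / N ≤ ((k.succ : Fin _) : ℝ) / N
    gcongr
    simp
  have g0 : ∀ N : ℕ, gridPoint (0 : Fin (N + 1)) = 0 := fun N => by
    ext; simp [gridPoint]
  have g1 : ∀ N : ℕ, 0 < N → gridPoint (Fin.last N) = 1 := fun N hN => by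
    have : (N : ℝ) ≠ 0 := by positivity
    ext; simp [gridPoint, this]
  have gd : ∀ (N : ℕ) (k : Fin N), (gridPoint k.succ : ℝ) - gridPoint k.castSucc = 1 / N :=
    fun N k => by
    simp [gridPoint]; ring
  have e : ∀ a b c d, rectVolume C a b c d = C b d - C b c - (C a d - C a c) :=
    fun a b c d => by rw [rectVolume]; ring
  have e' : ∀ a b c d, rectVolume C a b c d = C b d - C a d - (C b c - C a c) :=
    fun a b c d => by rw [rectVolume]; ring
  constructor
  · intro k l
    exact mul_nonneg (by positivity) (hC.two_increasing _ _ _ _ (gm _ k) (gm _ l))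
  · intro l
    simp only [inducedMatrix, Matrix.of_apply, ← Finset.mul_sum]
    have h := sum_succ_sub (fun k : Fin (N₁ + 1) =>
      C (gridPoint k) (gridPoint l.succ) - C (gridPoint k) (gridPoint l.castSucc))
    simp only [g0, g1 _ h₁, hC.one_left, hC.zero_left, gd] at h
    rw [Finset.sum_congr rfl fun k _ => e _ _ _ _, h]
    field_simp
    simp
  · intro k
    simp only [inducedMatrix, Matrix.of_apply, ← Finset.mul_sum]
    have h := sum_succ_sub (fun l : Fin (N₂ + 1) =>
      C (gridPoint k.succ) (gridPoint l) - C (gridPoint k.castSucc) (gridPoint l))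
    simp only [g0, g1 _ h₂, hC.one_right, hC.zero_right, gd] at h
    rw [Finset.sum_congr rfl fun l _ => e' _ _ _ _, h]
    field_simp
    simp

theorem sampleRank_bij {n : ℕ} {x : Fin n → ℝ} (hx : Function.Injective x) (i : Fin n) :
    ∃! k, sampleRank x k = (i : ℕ) + 1 := by
  have lt : ∀ k l, x k < x l → sampleRank x k < sampleRank x l := fun k l h => by
    refine Set.ncard_lt_ncard ⟨fun j (hj : x j ≤ x k) => (hj.trans h.le : x j ≤ x l), fun hh => ?_⟩
      (Set.toFinite _)
    have : x l ≤ x k := hh (le_refl (x l) : x l ≤ x l)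
    linarith
  have inj : Function.Injective (sampleRank x) := fun k l h => by
    by_contra hne
    rcases lt_or_gt_of_ne (hx.ne hne) with h' | h'
    · exact (lt _ _ h').ne h
    · exact (lt _ _ h').ne h.symm
  have pos : ∀ k, 0 < sampleRank x k := fun k =>
    (Set.ncard_pos (Set.toFinite _)).2 ⟨k, (le_refl (x k) : x k ≤ x k)⟩
  have le : ∀ k, sampleRank x k ≤ n := fun k => by
    have h := Set.ncard_le_ncard (Set.subset_univ {j : Fin n | x j ≤ x k}) (Set.toFinite _)
    rwa [Set.ncard_univ, Nat.card_fin] at h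
  let r : Fin n → Fin n := fun k => ⟨sampleRank x k - 1, by have := pos k; have := le k; omega⟩
  have rinj : Function.Injective r := fun k l h => inj (by
    have := congrArg Fin.val h
    have := pos k; have := pos l
    simp only [r] at *
    omega)
  obtain ⟨k, hk⟩ := (Finite.injective_iff_surjective.1 rinj) i
  have hk' : sampleRank x k = (i : ℕ) + 1 := by
    have := congrArg Fin.val hk; have := pos k; simp only [r] at *; omega
  exact ⟨k, hk', fun l hl => inj (hl.trans hk'.symm)⟩

theorem isCheckerboardMatrix_rankMatrix {n : ℕ} {x y : Fin n → ℝ} (hx : Function.Injective x)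
    (hy : Function.Injective y) : IsCheckerboardMatrix ((n : ℝ) • rankMatrix x y) := by
  have ux : ∀ k, ∃ i : Fin n, sampleRank x k = (i : ℕ) + 1 := fun k => by
    have h : Function.Surjective fun i : Fin n => (sampleRank_bij hx i).choose := by
      refine Finite.injective_iff_surjective.1 fun i j h => ?_
      have hi := (sampleRank_bij hx i).choose_spec.1
      have hj := (sampleRank_bij hx j).choose_spec.1
      simp only at h hi hj
      rw [h] at hi
      exact Fin.ext (by omega)
    obtain ⟨i, hi⟩ := h k
    exact ⟨i, hi ▸ (sampleRank_bij hx i).choose_spec.1⟩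
  have uy : ∀ k, ∃ i : Fin n, sampleRank y k = (i : ℕ) + 1 := fun k => by
    have h : Function.Surjective fun i : Fin n => (sampleRank_bij hy i).choose := by
      refine Finite.injective_iff_surjective.1 fun i j h => ?_
      have hi := (sampleRank_bij hy i).choose_spec.1
      have hj := (sampleRank_bij hy j).choose_spec.1
      simp only at h hi hj
      rw [h] at hi
      exact Fin.ext (by omega)
    obtain ⟨i, hi⟩ := h k
    exact ⟨i, hi ▸ (sampleRank_bij hy i).choose_spec.1⟩
  constructor
  · intro k l
    simp only [rankMatrix, Matrix.smul_apply, Matrix.of_apply]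
    split_ifs <;> simp
  · intro j
    obtain ⟨k, hk, hku⟩ := sampleRank_bij hy j
    obtain ⟨i, hi⟩ := ux k
    simp only [rankMatrix, Matrix.smul_apply, Matrix.of_apply]
    rw [Finset.sum_eq_single i, if_pos ⟨k, hi, hk⟩]
    · simp
    · intro i' _ hne
      rw [if_neg]; · simp
      rintro ⟨k', h1, h2⟩
      rw [hku k' h2] at h1
      exact hne (Fin.ext (by omega))
    · simp
  · intro i
    obtain ⟨k, hk, hku⟩ := sampleRank_bij hx i
    obtain ⟨j, hj⟩ := uy k
    simp only [rankMatrix, Matrix.smul_apply, Matrix.of_apply]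
    rw [Finset.sum_eq_single j, if_pos ⟨k, hk, hj⟩]
    · simp
    · intro j' _ hne
      rw [if_neg]; · simp
      rintro ⟨k', h1, h2⟩
      rw [hku k' h1] at h2
      exact hne (Fin.ext (by omega))
    · simp

/-- Without ties the empirical checkerboard is a copula. -/
theorem isCopula_empiricalCheckerboard {n N₁ N₂ : ℕ} (hn : 0 < n) (h₁ : 0 < N₁) (h₂ : 0 < N₂)
    {x y : Fin n → ℝ} (hx : Function.Injective x) (hy : Function.Injective y) :
    IsCopula (empiricalCheckerboard N₁ N₂ x y) :=
  isCopula_checkerboard h₁ h₂ ((isCopula_checkerboard hn hn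
    (isCheckerboardMatrix_rankMatrix hx hy)).isCheckerboardMatrix h₁ h₂)

end CheckerboardFacts

open Classical in
/-- The rearranged `μ`-estimate `R_μ` of the empirical checkerboard copula. The latter is a
copula whenever there are no ties and `n, N₁, N₂` are positive
(`isCopula_empiricalCheckerboard`); if it is not a copula, the estimate is set to `0`. -/
noncomputable def rearrangedEstimate (μ : Copula → ℝ) {n : ℕ} (N₁ N₂ : ℕ) (x y : Fin n → ℝ) : ℝ :=
  if h : IsCopula (empiricalCheckerboard N₁ N₂ x y) then
    rearrangedMeasure μ ⟨empiricalCheckerboard N₁ N₂ x y, h⟩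
  else 0

/-- The distribution function of a law on the line, as a function into the unit interval. -/
noncomputable def cdfUnit (ρ : Measure ℝ) (x : ℝ) : unitInterval :=
  ⟨cdf ρ x, cdf_nonneg ρ x, cdf_le_one ρ x⟩

/-- The joint distribution function `F(x, y)` of a law on the plane. -/
noncomputable def jointCdf (ρ : Measure (ℝ × ℝ)) (x y : ℝ) : ℝ :=
  ρ.real (Iic x ×ˢ Iic y)

/-- `C` is the copula of the law `ρ` with marginal distribution functions `F_X, F_Y`:
`C(F_X(x), F_Y(y)) = F(x, y)`. -/
def IsCopulaOf (C : Copula) (ρ : Measure (ℝ × ℝ)) : Prop :=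
  ∀ x y, C.1 (cdfUnit (ρ.map Prod.fst) x) (cdfUnit (ρ.map Prod.snd) y) = jointCdf ρ x y

/-!
By the continuity of `μ` on stochastically increasing copulas, and since every rearranged copula is
stochastically increasing (`isStochasticallyIncreasing_siRearrangement`), it suffices that almost
surely the rearranged empirical checkerboard copulas converge pointwise to `C^↑`. The argument has
a deterministic and a probabilistic half.

*Deterministic half.* The functional `f ↦ ∫₀ᵘ f^*` is nonexpansive for the `L¹` distance
(`abs_integral_decreasingRearrangement_sub_le`), so `L¹` convergence of the partial derivatives
`∂₁(·, v)` is enough. The partial derivative of a checkerboard is the step function of its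
difference quotients over the `N₁` cells, called `cellSlope` below. For `C` itself these step
functions converge to `∂₁C(·, v)` at each point of differentiability (`tendsto_cellSlope`). A
checkerboard agrees with the function inducing it on the grid only, so `v` is first moved to a grid
point `w` at distance at most `1/N₂`. This costs at most `1/N₂` on either side: the rearranged
checkerboard is a copula and hence Lipschitz, and the cell slopes of `C` at `w` and `v` are ordered
with integrals `w` and `v`. Replacing `C` by an approximation `E` with uniform error `δ` changes
the cell slopes by at most `2 N₁ δ`, so that, besides `N₁, N₂ → ∞`, only `N₁ δ → 0` is required
(`tendsto_siRearrangementFun_checkerboard`).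

*Probabilistic half.* Ranks are unchanged by the probability integral transforms `U = F_X(X)`,
`V = F_Y(Y)`, whose joint distribution function on the unit square is `C`
(`measureReal_cdf_le_and_cdf_le`). The empirical copula at a grid point is the empirical
distribution function of `(U, V)` at a pair of order statistics, so its uniform distance from `C`
is at most three times the distance of this empirical distribution function from `C`, up to `4/n`
(`abs_checkerboard_rankMatrix_sub_le`). By Hoeffding's inequality on the grid of mesh `1/n`, the
union bound and the Borel–Cantelli lemma, the latter distance is eventually at most `n⁻ˢ + 2/n`
almost surely, for each `s < 1/2` (`ae_eventually_abs_empiricalCdf_sub_le`). With `s₁ < s < 1/2`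
the product of `N₁ ≤ n ^ s₁` and this bound tends to zero.
-/

/-! ### Copulas and their rearrangements -/

/-- Copulas are Lipschitz: each increment is dominated by that of the uniform margin. -/
theorem IsCopula.abs_sub_le {C : unitInterval → unitInterval → ℝ} (hC : IsCopula C)
    (u u' v v' : unitInterval) :
    |C u v - C u' v'| ≤ |(u : ℝ) - u'| + |(v : ℝ) - v'| := by
  have left : ∀ {a b : unitInterval} (v), a ≤ b → |C a v - C b v| ≤ |(a : ℝ) - b| := by
    intro a b v hab
    have h0 := hC.two_increasing a b 0 v hab v.2.1
    have h1 := hC.two_increasing a b v 1 hab v.2.2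
    simp only [rectVolume, hC.zero_right, hC.one_right] at h0 h1
    have : (a : ℝ) ≤ b := hab
    rw [abs_sub_comm, abs_sub_comm (a : ℝ), abs_of_nonneg, abs_of_nonneg] <;> linarith
  have right : ∀ {a b : unitInterval} (u), a ≤ b → |C u a - C u b| ≤ |(a : ℝ) - b| := by
    intro a b u hab
    have h0 := hC.two_increasing 0 u a b u.2.1 hab
    have h1 := hC.two_increasing u 1 a b u.2.2 hab
    simp only [rectVolume, hC.zero_left, hC.one_left] at h0 h1
    have : (a : ℝ) ≤ b := hab
    rw [abs_sub_comm, abs_sub_comm (a : ℝ), abs_of_nonneg, abs_of_nonneg] <;> linarith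
  have h1 : |C u v - C u' v| ≤ |(u : ℝ) - u'| := by
    rcases le_total u u' with h | h
    · exact left v h
    · rw [abs_sub_comm, abs_sub_comm (u : ℝ)]; exact left v h
  have h2 : |C u' v - C u' v'| ≤ |(v : ℝ) - v'| := by
    rcases le_total v v' with h | h
    · exact right u' h
    · rw [abs_sub_comm, abs_sub_comm (v : ℝ)]; exact right u' h
  exact (_root_.abs_sub_le _ (C u' v) _).trans (add_le_add h1 h2)

theorem intervalIntegrable_of_mem_Icc {f : ℝ → ℝ} (hf : Measurable f)
    (h : ∀ u, f u ∈ Icc (0 : ℝ) 1) : IntervalIntegrable f volume 0 1 := by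
  rw [intervalIntegrable_iff_integrableOn_Ico_of_le zero_le_one]
  refine Integrable.of_bound hf.aestronglyMeasurable 1 (ae_of_all _ fun t => ?_)
  rw [Real.norm_eq_abs, abs_of_nonneg (h t).1]
  exact (h t).2

/-- The rearrangement operator, followed by integration over an initial interval, is
nonexpansive for the `L¹` distance. The bound follows from monotonicity and equimeasurability by
comparing `f` and `g` through `max f g`. -/
theorem abs_integral_decreasingRearrangement_sub_le {f g : ℝ → ℝ} (hf : Measurable f)
    (hg : Measurable g) (hf0 : ∀ u, 0 ≤ f u) (hf1 : ∀ u, f u ≤ 1) (hg0 : ∀ u, 0 ≤ g u)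
    (hg1 : ∀ u, g u ≤ 1) {a : ℝ} (ha : a ∈ Icc (0 : ℝ) 1) :
    |(∫ s in (0 : ℝ)..a, decreasingRearrangement f s) -
      ∫ s in (0 : ℝ)..a, decreasingRearrangement g s| ≤ ∫ s in (0 : ℝ)..1, |f s - g s| := by
  have bint : ∀ {h : ℝ → ℝ}, Measurable h → (∀ u, 0 ≤ h u) → (∀ u, h u ≤ 1) →
      IntervalIntegrable h volume 0 1 := fun hm h0 h1 =>
    intervalIntegrable_of_mem_Icc hm fun u => ⟨h0 u, h1 u⟩
  have one_side : ∀ {f g : ℝ → ℝ}, Measurable f → Measurable g → (∀ u, 0 ≤ f u) →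
      (∀ u, f u ≤ 1) → (∀ u, 0 ≤ g u) → (∀ u, g u ≤ 1) →
      (∫ s in (0 : ℝ)..a, decreasingRearrangement f s) -
        ∫ s in (0 : ℝ)..a, decreasingRearrangement g s ≤ ∫ s in (0 : ℝ)..1, |f s - g s| := by
    intro f g hf hg hf0 hf1 hg0 hg1
    set m : ℝ → ℝ := fun u => max (f u) (g u) with hm
    have m0 : ∀ u, 0 ≤ m u := fun u => (hf0 u).trans (le_max_left _ _)
    have m1 : ∀ u, m u ≤ 1 := fun u => max_le (hf1 u) (hg1 u)
    have mm : Measurable m := hf.max hg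
    have z : (0 : ℝ) ∈ Icc (0 : ℝ) 1 := by simp
    have o : (1 : ℝ) ∈ Icc (0 : ℝ) 1 := by simp
    have I1 := intervalIntegrable_decreasingRearrangement hf0 hf1 z ha
    have I2 := intervalIntegrable_decreasingRearrangement hg0 hg1 z ha
    have I3 := intervalIntegrable_decreasingRearrangement m0 m1 z ha
    have I4 := intervalIntegrable_decreasingRearrangement m0 m1 ha o
    have I5 := intervalIntegrable_decreasingRearrangement hg0 hg1 ha o
    have h1 : ∫ s in (0 : ℝ)..a, decreasingRearrangement f s ≤
        ∫ s in (0 : ℝ)..a, decreasingRearrangement m s :=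
      intervalIntegral.integral_mono_on_of_le_Ioo ha.1 I1 I3 fun s hs =>
        decreasingRearrangement_mono hf0 hf1 m0 m1 (ae_of_all _ fun u => le_max_left _ _)
          (hs.2.trans_le ha.2)
    have h2 : ∫ s in a..1, decreasingRearrangement g s ≤
        ∫ s in a..1, decreasingRearrangement m s :=
      intervalIntegral.integral_mono_on_of_le_Ioo ha.2 I5 I4 fun s hs =>
        decreasingRearrangement_mono hg0 hg1 m0 m1 (ae_of_all _ fun u => le_max_right _ _) hs.2
    have h3 := integral_decreasingRearrangement mm m0 m1
    have h4 := integral_decreasingRearrangement hg hg0 hg1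
    rw [← intervalIntegral.integral_add_adjacent_intervals I3 I4] at h3
    rw [← intervalIntegral.integral_add_adjacent_intervals I2 I5] at h4
    have h5 : (∫ s in (0 : ℝ)..1, m s) - ∫ s in (0 : ℝ)..1, g s ≤
        ∫ s in (0 : ℝ)..1, |f s - g s| := by
      rw [← intervalIntegral.integral_sub (bint mm m0 m1) (bint hg hg0 hg1)]
      refine intervalIntegral.integral_mono_on zero_le_one
        ((bint mm m0 m1).sub (bint hg hg0 hg1))
        ((bint hf hf0 hf1).sub (bint hg hg0 hg1)).abs fun s _ => ?_
      rcases le_total (f s) (g s) with h | h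
      · simp [hm, max_eq_right h]
      · simp [hm, max_eq_left h, le_abs_self]
    linarith
  refine abs_sub_le_iff.2 ⟨one_side hf hg hf0 hf1 hg0 hg1, ?_⟩
  have h := one_side hg hf hg0 hg1 hf0 hf1
  simpa only [abs_sub_comm] using h

/-- On `[0,1]` the section of `C^↑` is the primitive of a decreasing function, so comparing it with
a linear function of slope `(∂₁C(·,v))^*(w)` on either side of an intermediate point `w`
orders the derivatives. -/
theorem isStochasticallyIncreasing_siRearrangement (C : Copula) :
    IsStochasticallyIncreasing (siRearrangement C) := by
  intro v a ha b hb hab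
  rcases hab.eq_or_lt with rfl | hlt
  · exact le_rfl
  obtain ⟨w, haw, hwb⟩ := exists_between hlt
  have h0 := C.2.partialOne_nonneg v
  have h1 := C.2.partialOne_le_one v
  set r := decreasingRearrangement (partialOne C.1 v) with hr
  have anti : AntitoneOn r (Iio 1) := decreasingRearrangement_antitoneOn h0 h1
  have hw0 : 0 < w := ha.1.1.trans haw
  have hw1 : w < 1 := hwb.trans hb.1.2
  set F := copulaSection (siRearrangement C).1 v with hF
  have hFx : ∀ x ∈ Icc (0 : ℝ) 1, F x = ∫ s in (0 : ℝ)..x, r s := fun x hx => by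
    simp [hF, copulaSection, siRearrangement, siRearrangementFun, projIcc_of_mem _ hx, hr]
  have incr : ∀ x ∈ Icc (0 : ℝ) 1, ∀ y ∈ Icc (0 : ℝ) 1, F y - F x = ∫ s in x..y, r s := by
    intro x hx y hy
    rw [hFx x hx, hFx y hy]
    exact intervalIntegral.integral_interval_sub_left
      (intervalIntegrable_decreasingRearrangement h0 h1 (by simp) hy)
      (intervalIntegrable_decreasingRearrangement h0 h1 (by simp) hx)
  have left : r w ≤ deriv F a := by
    have mono : MonotoneOn (fun x => F x - r w * x) (Icc 0 w) := by
      intro x hx y hy hxy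
      have hx' : x ∈ Icc (0 : ℝ) 1 := ⟨hx.1, hx.2.trans hw1.le⟩
      have hy' : y ∈ Icc (0 : ℝ) 1 := ⟨hy.1, hy.2.trans hw1.le⟩
      have := intervalIntegral.integral_mono_on_of_le_Ioo (μ := volume) (f := fun _ => r w) hxy
        (by simp) (intervalIntegrable_decreasingRearrangement h0 h1 hx' hy')
        fun s hs => anti ((hs.2.trans_le hy.2).trans hw1) hw1 (hs.2.trans_le hy.2).le
      rw [← hr, ← incr x hx' y hy', intervalIntegral.integral_const, smul_eq_mul] at this
      dsimp only
      linarith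
    have := mono.derivWithin_nonneg (x := a)
    rw [derivWithin_of_mem_nhds (Icc_mem_nhds ha.1.1 haw), deriv_fun_sub ha.2 (by fun_prop),
      deriv_const_mul_field, deriv_id''] at this
    linarith
  have right : deriv F b ≤ r w := by
    have mono : MonotoneOn (fun x => r w * x - F x) (Icc w 1) := by
      intro x hx y hy hxy
      have hx' : x ∈ Icc (0 : ℝ) 1 := ⟨hw0.le.trans hx.1, hx.2⟩
      have hy' : y ∈ Icc (0 : ℝ) 1 := ⟨hw0.le.trans hy.1, hy.2⟩
      have := intervalIntegral.integral_mono_on_of_le_Ioo (μ := volume) (g := fun _ => r w) hxy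
        (intervalIntegrable_decreasingRearrangement h0 h1 hx' hy') (by simp)
        fun s hs => anti hw1 (hs.2.trans_le hy.2) (hx.1.trans hs.1.le)
      rw [← hr, ← incr x hx' y hy', intervalIntegral.integral_const, smul_eq_mul] at this
      dsimp only
      linarith
    have := mono.derivWithin_nonneg (x := b)
    rw [derivWithin_of_mem_nhds (Icc_mem_nhds hwb hb.1.2), deriv_fun_sub (by fun_prop) hb.2,
      deriv_const_mul_field, deriv_id''] at this
    linarith
  exact right.trans left

/-! ### Cell slopes -/

/-- The step function whose value on the cell `[k/N, (k+1)/N)` is the difference quotient of `g`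
over this cell. (For negative `u` the value is that of the first cell.) -/
noncomputable def cellSlope (g : ℝ → ℝ) (N : ℕ) (u : ℝ) : ℝ :=
  N * (g (((⌊u * N⌋₊ : ℝ) + 1) / N) - g ((⌊u * N⌋₊ : ℝ) / N))

theorem measurable_cellSlope (g : ℝ → ℝ) (N : ℕ) : Measurable (cellSlope g N) := by
  have h : Measurable fun k : ℕ => (N : ℝ) * (g (((k : ℝ) + 1) / N) - g ((k : ℝ) / N)) :=
    measurable_of_countable _
  exact h.comp (Nat.measurable_floor.comp (measurable_id.mul_const _))

theorem cellSlope_mono {f g : ℝ → ℝ} (h : Monotone fun u => g u - f u) (N : ℕ) (u : ℝ) :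
    cellSlope f N u ≤ cellSlope g N u := by
  refine mul_le_mul_of_nonneg_left ?_ (Nat.cast_nonneg _)
  have : (⌊u * N⌋₊ : ℝ) / N ≤ ((⌊u * N⌋₊ : ℝ) + 1) / N := by gcongr; linarith
  have := h this
  dsimp only at this
  linarith

theorem cellSlope_nonneg {g : ℝ → ℝ} (hg : Monotone g) (N : ℕ) (u : ℝ) : 0 ≤ cellSlope g N u := by
  have h := cellSlope_mono (f := fun _ => 0) (g := g) (by simpa using hg) N u
  simpa [cellSlope] using h

theorem cellSlope_le_one {g : ℝ → ℝ} (hg : LipschitzWith 1 g) (N : ℕ) (u : ℝ) :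
    cellSlope g N u ≤ 1 := by
  rcases N.eq_zero_or_pos with rfl | hN
  · simp [cellSlope]
  have hN' : (0 : ℝ) < N := by exact_mod_cast hN
  have h := hg.dist_le_mul (((⌊u * N⌋₊ : ℝ) + 1) / N) ((⌊u * N⌋₊ : ℝ) / N)
  rw [Real.dist_eq, Real.dist_eq, ← sub_div, add_sub_cancel_left, NNReal.coe_one, one_mul,
    abs_of_pos (by positivity : (0 : ℝ) < 1 / N)] at h
  calc cellSlope g N u ≤ N * (1 / N) := by
        unfold cellSlope; gcongr; exact (le_abs_self _).trans h
    _ = 1 := by field_simp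

theorem floor_mul_eq_of_mem_Ico {N k : ℕ} (hN : 0 < N) {u : ℝ}
    (hu : u ∈ Ico ((k : ℝ) / N) (((k : ℝ) + 1) / N)) : ⌊u * N⌋₊ = k := by
  have hN' : (0 : ℝ) < N := by exact_mod_cast hN
  have h1 := (div_le_iff₀ hN').1 hu.1
  have h2 := (lt_div_iff₀ hN').1 hu.2
  exact (Nat.floor_eq_iff ((Nat.cast_nonneg _).trans h1)).2 ⟨h1, h2⟩

theorem mem_Ico_floor_mul {N : ℕ} (hN : 0 < N) {u : ℝ} (hu : 0 ≤ u) :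
    u ∈ Ico ((⌊u * N⌋₊ : ℝ) / N) (((⌊u * N⌋₊ : ℝ) + 1) / N) := by
  have hN' : (0 : ℝ) < N := by exact_mod_cast hN
  exact ⟨(div_le_iff₀ hN').2 (Nat.floor_le (by positivity)),
    (lt_div_iff₀ hN').2 (Nat.lt_floor_add_one _)⟩

theorem integral_cellSlope (g : ℝ → ℝ) {N : ℕ} (hN : 0 < N) :
    ∫ u in (0 : ℝ)..1, cellSlope g N u = g 1 - g 0 := by
  have hN' : (0 : ℝ) < N := by exact_mod_cast hN
  have hle : ∀ k : ℕ, (k : ℝ) / N ≤ ((k + 1 : ℕ) : ℝ) / N := fun k => by gcongr; linarith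
  have hcell : ∀ k : ℕ, ∀ u ∈ Ioo ((k : ℝ) / N) (((k + 1 : ℕ) : ℝ) / N),
      cellSlope g N u = N * (g (((k + 1 : ℕ) : ℝ) / N) - g ((k : ℝ) / N)) := by
    intro k u hu
    rw [cellSlope, floor_mul_eq_of_mem_Ico hN (k := k) (by push_cast at hu; exact ⟨hu.1.le, hu.2⟩)]
    push_cast
    rfl
  have hint : ∀ k : ℕ, IntervalIntegrable (cellSlope g N) volume ((k : ℝ) / N)
      (((k + 1 : ℕ) : ℝ) / N) := by
    intro k
    refine (intervalIntegrable_const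
      (c := N * (g (((k + 1 : ℕ) : ℝ) / N) - g ((k : ℝ) / N)))).congr_uIoo ?_
    rw [uIoo_of_le (hle k)]
    exact fun u hu => (hcell k u hu).symm
  have h := intervalIntegral.sum_integral_adjacent_intervals (μ := volume)
    (f := cellSlope g N) (a := fun k : ℕ => (k : ℝ) / N) (n := N) fun k _ => hint k
  have hk : ∀ k : ℕ, ∫ u in ((k : ℝ) / N)..(((k + 1 : ℕ) : ℝ) / N), cellSlope g N u =
      g (((k + 1 : ℕ) : ℝ) / N) - g ((k : ℝ) / N) := by
    intro k
    rw [intervalIntegral.integral_congr_uIoo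
      (g := fun _ => N * (g (((k + 1 : ℕ) : ℝ) / N) - g ((k : ℝ) / N)))
      (by rw [uIoo_of_le (hle k)]; exact hcell k), intervalIntegral.integral_const, smul_eq_mul]
    push_cast
    field_simp
    ring
  simp only [hk, Finset.sum_range_sub (fun k : ℕ => g ((k : ℝ) / N))] at h
  simp only [Nat.cast_zero, zero_div, div_self hN'.ne'] at h
  exact h.symm

/-- The cells around `u` shrink to `u`, so their difference quotients converge to the derivative. -/
theorem tendsto_cellSlope {g : ℝ → ℝ} {u : ℝ} (hu : 0 ≤ u) (hg : DifferentiableAt ℝ g u) {N : ℕ → ℕ}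
    (hN : Tendsto N atTop atTop) :
    Tendsto (fun n => cellSlope g (N n) u) atTop (𝓝 (deriv g u)) := by
  rw [Metric.tendsto_nhds]
  intro ε hε
  have h := (hasDerivAt_iff_isLittleO.1 hg.hasDerivAt).def (half_pos hε)
  obtain ⟨δ, hδ, h⟩ := Metric.eventually_nhds_iff.1 h
  have hN' := tendsto_natCast_atTop_atTop (R := ℝ).comp hN
  filter_upwards [hN.eventually_gt_atTop 0, hN'.eventually_gt_atTop (1 / δ)] with n hn hn'
  have hp : (0 : ℝ) < N n := by exact_mod_cast hn
  have hm := mem_Ico_floor_mul hn hu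
  unfold cellSlope
  set a := (⌊u * N n⌋₊ : ℝ) / N n
  set b := ((⌊u * N n⌋₊ : ℝ) + 1) / N n with hb
  have hab : b - a = 1 / N n := by rw [hb, ← sub_div]; simp
  have hlt : b - a < δ := by
    rw [hab, div_lt_iff₀ hp]
    rw [Function.comp_apply, div_lt_iff₀ hδ] at hn'
    linarith
  have h1 := h (y := a) (by rw [Real.dist_eq, abs_lt]; constructor <;> linarith [hm.1, hm.2])
  have h2 := h (y := b) (by rw [Real.dist_eq, abs_lt]; constructor <;> linarith [hm.1, hm.2])
  simp only [Real.norm_eq_abs, smul_eq_mul] at h1 h2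
  rw [abs_of_nonpos (by linarith [hm.1] : a - u ≤ 0)] at h1
  rw [abs_of_nonneg (by linarith [hm.2] : 0 ≤ b - u)] at h2
  have h3 : |g b - g a - deriv g u * (b - a)| ≤ ε / 2 * (1 / N n) := by
    rw [← hab]
    rw [abs_le] at *
    constructor <;> linarith
  have e : N n * (g b - g a) - deriv g u = N n * (g b - g a - deriv g u * (b - a)) := by
    rw [hab]; field_simp
  rw [Real.dist_eq, e, abs_mul, abs_of_pos hp]
  calc (N n : ℝ) * |g b - g a - deriv g u * (b - a)| ≤ N n * (ε / 2 * (1 / N n)) := by gcongr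
    _ = ε / 2 := by field_simp
    _ < ε := half_lt_self hε

/-! ### Checkerboard functions -/

/-- The primitive, vanishing at `0`, of the indicator function of the cell `[k/N, (k+1)/N)`. -/
noncomputable def cellRamp (N k : ℕ) (x : ℝ) : ℝ := min x (((k : ℝ) + 1) / N) - min x ((k : ℝ) / N)

theorem checkerboard_eq_sum_cellRamp {N₁ N₂ : ℕ} (A : Matrix (Fin N₁) (Fin N₂) ℝ)
    (u v : unitInterval) :
    checkerboard A u v = ∑ k : Fin N₁, ∑ l : Fin N₂, A k l * cellRamp N₁ k u * cellRamp N₂ l v := by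
  have cell : ∀ (N : ℕ) (k : Fin N) (u : unitInterval),
      ∫ s in (0 : ℝ)..u, (Ico ((k : ℝ) / N) (((k : ℝ) + 1) / N)).indicator (fun _ => (1 : ℝ)) s
        = cellRamp N k u := fun N k u =>
    cell_integral (by positivity) (by gcongr; linarith) u.2.1
  simp only [checkerboard, cell]

theorem cellRamp_of_mem_Icc {N k j : ℕ} {x : ℝ}
    (hx : x ∈ Icc ((j : ℝ) / N) (((j : ℝ) + 1) / N)) :
    cellRamp N k x = if k < j then 1 / (N : ℝ) else if k = j then x - (j : ℝ) / N else 0 := by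
  unfold cellRamp
  split_ifs with h1 h2
  · have h : (k : ℝ) + 1 ≤ j := by exact_mod_cast h1
    have h3 : ((k : ℝ) + 1) / N ≤ (j : ℝ) / N := by gcongr
    have h4 : (k : ℝ) / N ≤ ((k : ℝ) + 1) / N := by gcongr; linarith
    rw [min_eq_right (h3.trans hx.1), min_eq_right ((h4.trans h3).trans hx.1)]
    ring
  · subst h2
    rw [min_eq_left hx.2, min_eq_right hx.1]
  · have h : (j : ℝ) + 1 ≤ k := by exact_mod_cast (by omega : j + 1 ≤ k)
    have h3 : ((j : ℝ) + 1) / N ≤ (k : ℝ) / N := by gcongr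
    have h4 : (k : ℝ) / N ≤ ((k : ℝ) + 1) / N := by gcongr; linarith
    rw [min_eq_left (hx.2.trans (h3.trans h4)), min_eq_left (hx.2.trans h3), sub_self]

theorem cellRamp_grid (N k j : ℕ) :
    cellRamp N k ((j : ℝ) / N) = if k < j then 1 / (N : ℝ) else 0 := by
  rw [cellRamp_of_mem_Icc (j := j) ⟨le_rfl, by gcongr; linarith⟩]
  simp

theorem cellRamp_affine {N : ℕ} (hN : 0 < N) (k : ℕ) {j : ℕ} {x : ℝ}
    (hx : x ∈ Icc ((j : ℝ) / N) (((j : ℝ) + 1) / N)) :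
    cellRamp N k x = cellRamp N k ((j : ℝ) / N) +
      (x - (j : ℝ) / N) * (N * (cellRamp N k (((j : ℝ) + 1) / N) - cellRamp N k ((j : ℝ) / N))) := by
  have hN' : (0 : ℝ) < N := by exact_mod_cast hN
  have h : (j : ℝ) / N ≤ ((j : ℝ) + 1) / N := by gcongr; linarith
  rw [cellRamp_of_mem_Icc hx, cellRamp_of_mem_Icc (k := k) ⟨le_rfl, h⟩,
    cellRamp_of_mem_Icc (k := k) ⟨h, le_rfl⟩]
  split_ifs
  · ring
  · field_simp; ring
  · ring

/-- Inside the cells a checkerboard function is affine in its first argument. -/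
theorem partialOne_checkerboard {N₁ N₂ : ℕ} (h₁ : 0 < N₁) (A : Matrix (Fin N₁) (Fin N₂) ℝ)
    (v : unitInterval) {u : ℝ} (hu : u ∈ Ioo (0 : ℝ) 1) (hgrid : ∀ k : ℕ, u ≠ (k : ℝ) / N₁) :
    partialOne (checkerboard A) v u = cellSlope (copulaSection (checkerboard A) v) N₁ u := by
  have hp : (0 : ℝ) < N₁ := by exact_mod_cast h₁
  have hm := mem_Ico_floor_mul h₁ hu.1.le
  unfold cellSlope
  set j := ⌊u * N₁⌋₊ with hj
  have hjN : j + 1 ≤ N₁ := by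
    have : (j : ℝ) / N₁ < 1 := hm.1.trans_lt hu.2
    rw [div_lt_one hp] at this
    exact_mod_cast this
  have hb : ((j : ℝ) + 1) / N₁ ≤ 1 := by rw [div_le_one hp]; exact_mod_cast hjN
  have ha : 0 ≤ (j : ℝ) / N₁ := by positivity
  have hab : (j : ℝ) / N₁ ≤ ((j : ℝ) + 1) / N₁ := by gcongr; linarith
  set g := copulaSection (checkerboard A) v with hg
  have hgx : ∀ x ∈ Icc (0 : ℝ) 1, g x =
      ∑ k : Fin N₁, (∑ l : Fin N₂, A k l * cellRamp N₂ l v) * cellRamp N₁ k x := by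
    intro x hx
    rw [hg, copulaSection, checkerboard_eq_sum_cellRamp, projIcc_of_mem _ hx]
    refine Finset.sum_congr rfl fun k _ => ?_
    rw [Finset.sum_mul]
    exact Finset.sum_congr rfl fun l _ => by ring
  have haff : ∀ x ∈ Icc ((j : ℝ) / N₁) (((j : ℝ) + 1) / N₁), g x = g ((j : ℝ) / N₁) +
      (x - (j : ℝ) / N₁) * (N₁ * (g (((j : ℝ) + 1) / N₁) - g ((j : ℝ) / N₁))) := by
    intro x hx
    rw [hgx x ⟨ha.trans hx.1, hx.2.trans hb⟩, hgx _ ⟨ha, hab.trans hb⟩, hgx _ ⟨ha.trans hab, hb⟩,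
      ← Finset.sum_sub_distrib, Finset.mul_sum, Finset.mul_sum, ← Finset.sum_add_distrib]
    refine Finset.sum_congr rfl fun k _ => ?_
    rw [cellRamp_affine h₁ k hx]
    ring
  have hev : g =ᶠ[𝓝 u] fun x => g ((j : ℝ) / N₁) +
      (x - (j : ℝ) / N₁) * (N₁ * (g (((j : ℝ) + 1) / N₁) - g ((j : ℝ) / N₁))) := by
    filter_upwards [Ioo_mem_nhds (lt_of_le_of_ne hm.1 (hgrid j).symm) hm.2] with x hx
    exact haff x (Ioo_subset_Icc_self hx)
  rw [partialOne, ← hg, hev.deriv_eq]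
  simp

theorem ae_partialOne_checkerboard {N₁ N₂ : ℕ} (h₁ : 0 < N₁) (A : Matrix (Fin N₁) (Fin N₂) ℝ)
    (v : unitInterval) : ∀ᵐ u : ℝ, u ∈ Ioo (0 : ℝ) 1 →
      partialOne (checkerboard A) v u = cellSlope (copulaSection (checkerboard A) v) N₁ u := by
  have h : ∀ᵐ u : ℝ, u ∉ range fun k : ℕ => (k : ℝ) / N₁ :=
    measure_eq_zero_iff_ae_notMem.1 ((countable_range _).measure_zero _)
  filter_upwards [h] with u hu hu01
  exact partialOne_checkerboard h₁ A v hu01 fun k hk => hu ⟨k, hk.symm⟩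

theorem checkerboard_grid {N₁ N₂ : ℕ} (A : Matrix (Fin N₁) (Fin N₂) ℝ)
    (i : Fin (N₁ + 1)) (j : Fin (N₂ + 1)) :
    checkerboard A (gridPoint i) (gridPoint j) =
      (∑ k : Fin N₁, ∑ l : Fin N₂, if (k : ℕ) < i ∧ (l : ℕ) < j then A k l else 0) / (N₁ * N₂) := by
  rw [checkerboard_eq_sum_cellRamp, Finset.sum_div]
  refine Finset.sum_congr rfl fun k _ => ?_
  rw [Finset.sum_div]
  refine Finset.sum_congr rfl fun l _ => ?_
  simp only [gridPoint, cellRamp_grid]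
  by_cases hk : (k : ℕ) < i <;> by_cases hl : (l : ℕ) < j <;> simp [hk, hl]
  ring

/-- A telescoping sum over the indices below `i`. -/
theorem sum_lt_succ_sub {N : ℕ} (g : Fin (N + 1) → ℝ) (i : Fin (N + 1)) :
    ∑ k : Fin N, (if (k : ℕ) < i then g k.succ - g k.castSucc else 0) = g i - g 0 := by
  have h := sum_succ_sub fun k => g (min k i)
  rw [min_eq_right (Fin.le_last i), min_eq_left (Fin.zero_le i)] at h
  rw [← h]
  refine Finset.sum_congr rfl fun k _ => ?_
  split_ifs with hk
  · rw [min_eq_left (Fin.le_def.2 (by simpa using hk)),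
      min_eq_left (Fin.le_def.2 (by simpa using hk.le))]
  · rw [min_eq_right (Fin.le_def.2 (by simp; omega)),
      min_eq_right (Fin.le_def.2 (by simpa using hk)), sub_self]

/-- The induced checkerboard agrees with the original function on the grid. -/
theorem checkerboard_inducedMatrix_grid {N₁ N₂ : ℕ} (h₁ : 0 < N₁) (h₂ : 0 < N₂)
    {C : unitInterval → unitInterval → ℝ} (hC : IsCopula C)
    (i : Fin (N₁ + 1)) (j : Fin (N₂ + 1)) :
    checkerboard (inducedMatrix N₁ N₂ C) (gridPoint i) (gridPoint j) =
      C (gridPoint i) (gridPoint j) := by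
  have hp₁ : (0 : ℝ) < N₁ := by exact_mod_cast h₁
  have hp₂ : (0 : ℝ) < N₂ := by exact_mod_cast h₂
  have g0 : ∀ N : ℕ, gridPoint (0 : Fin (N + 1)) = 0 := fun N => by ext; simp [gridPoint]
  rw [checkerboard_grid, div_eq_iff (by positivity)]
  have inner : ∀ k : Fin N₁, ∑ l : Fin N₂, (if (k : ℕ) < i ∧ (l : ℕ) < j then
      inducedMatrix N₁ N₂ C k l else 0) = (N₁ * N₂) * (if (k : ℕ) < i then
        C (gridPoint k.succ) (gridPoint j) - C (gridPoint k.castSucc) (gridPoint j) else 0) := by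
    intro k
    split_ifs with hk
    · have h := sum_lt_succ_sub (fun l : Fin (N₂ + 1) => C (gridPoint k.succ) (gridPoint l) -
        C (gridPoint k.castSucc) (gridPoint l)) j
      rw [g0, hC.zero_right, hC.zero_right] at h
      rw [← sub_zero (C (gridPoint k.succ) _ - _), ← sub_self (0 : ℝ), ← h, Finset.mul_sum]
      refine Finset.sum_congr rfl fun l _ => ?_
      by_cases hl : (l : ℕ) < j
      · simp only [hk, hl, true_and, if_true, inducedMatrix, Matrix.of_apply, rectVolume]
        ring
      · simp [hl]
    · simp [hk]
  simp only [inner, ← Finset.mul_sum]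
  rw [sum_lt_succ_sub (fun k : Fin (N₁ + 1) => C (gridPoint k) (gridPoint j)) i, g0,
    hC.zero_left]
  ring

/-! ### Consistency for a deterministic sequence of copulas -/

theorem abs_cellSlope_sub_le {f g : ℝ → ℝ} {N : ℕ} (hN : 0 < N) {δ : ℝ}
    (h : ∀ k : ℕ, k ≤ N → |f ((k : ℝ) / N) - g ((k : ℝ) / N)| ≤ δ) {u : ℝ} (hu : u ∈ Ico (0 : ℝ) 1) :
    |cellSlope f N u - cellSlope g N u| ≤ N * (2 * δ) := by
  have hp : (0 : ℝ) < N := by exact_mod_cast hN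
  have hj : ⌊u * N⌋₊ + 1 ≤ N := by
    have : (⌊u * N⌋₊ : ℝ) / N < 1 := (mem_Ico_floor_mul hN hu.1).1.trans_lt hu.2
    rw [div_lt_one hp] at this
    exact_mod_cast this
  have a := h _ hj
  have b := h _ (Nat.le_of_succ_le hj)
  push_cast at a
  rw [cellSlope, cellSlope, ← mul_sub, abs_mul, abs_of_pos hp]
  gcongr
  rw [abs_le] at *
  constructor <;> linarith

theorem copulaSection_grid (C : unitInterval → unitInterval → ℝ) (v : unitInterval) {N k : ℕ}
    (hk : k ≤ N) : copulaSection C v ((k : ℝ) / N) =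
      C (gridPoint (⟨k, Nat.lt_succ_of_le hk⟩ : Fin (N + 1))) v := by
  have hm : (k : ℝ) / N ∈ Icc (0 : ℝ) 1 := (gridPoint (⟨k, Nat.lt_succ_of_le hk⟩ : Fin (N + 1))).2
  rw [copulaSection, projIcc_of_mem _ hm]
  rfl

/-- The cell slopes of a copula are bounded by `0` and `1`. -/
theorem IsCopula.cellSlope_mem {C : unitInterval → unitInterval → ℝ} (hC : IsCopula C)
    (v : unitInterval) (N : ℕ) (u : ℝ) : cellSlope (copulaSection C v) N u ∈ Icc (0 : ℝ) 1 :=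
  ⟨cellSlope_nonneg (hC.monotone_copulaSection v) N u,
    cellSlope_le_one (hC.lipschitzWith_copulaSection v) N u⟩

theorem IsCopula.tendsto_integral_abs_cellSlope_sub_partialOne
    {C : unitInterval → unitInterval → ℝ} (hC : IsCopula C) (v : unitInterval) {N : ℕ → ℕ}
    (hN : Tendsto N atTop atTop) :
    Tendsto (fun n => ∫ u in (0 : ℝ)..1,
      |cellSlope (copulaSection C v) (N n) u - partialOne C v u|) atTop (𝓝 0) := by
  have hm : Measurable (partialOne C v) := measurable_deriv _
  have h := intervalIntegral.tendsto_integral_filter_of_dominated_convergence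
    (μ := volume) (a := 0) (b := 1) (l := atTop) (f := fun _ => (0 : ℝ))
    (F := fun n u => |cellSlope (copulaSection C v) (N n) u - partialOne C v u|) (fun _ => 1)
    (Eventually.of_forall fun n => ((measurable_cellSlope _ _).sub hm).abs.aestronglyMeasurable)
    (Eventually.of_forall fun n => ae_of_all _ fun u _ => ?_) (by simp) ?_
  · simpa using h
  · have h1 := hC.cellSlope_mem v (N n) u
    have h2 := hC.partialOne_nonneg v u
    have h3 := hC.partialOne_le_one v u
    rw [Real.norm_eq_abs, abs_abs, abs_le]
    constructor <;> linarith [h1.1, h1.2]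
  · filter_upwards [hC.ae_differentiableAt v] with u hu hu0
    rw [uIoc_of_le zero_le_one] at hu0
    have := (tendsto_cellSlope hu0.1.le hu hN).sub_const (partialOne C v u)
    rw [partialOne, sub_self] at this
    simpa [partialOne] using this.abs

/-- Two sections of a copula have ordered cell slopes, so the `L¹` distance of these is the
difference of their integrals. -/
theorem IsCopula.integral_abs_cellSlope_sub {C : unitInterval → unitInterval → ℝ}
    (hC : IsCopula C) {w v : unitInterval} (hwv : w ≤ v) {N : ℕ} (hN : 0 < N) :
    ∫ u in (0 : ℝ)..1, |cellSlope (copulaSection C w) N u - cellSlope (copulaSection C v) N u| =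
      v - w := by
  have hle := cellSlope_mono (hC.copulaSection_sub_nonneg hwv) N
  have e : ∀ u, |cellSlope (copulaSection C w) N u - cellSlope (copulaSection C v) N u| =
      cellSlope (copulaSection C v) N u - cellSlope (copulaSection C w) N u := fun u => by
    rw [abs_sub_comm, abs_of_nonneg (sub_nonneg.2 (hle u))]
  simp only [e]
  rw [intervalIntegral.integral_sub
    (intervalIntegrable_of_mem_Icc (measurable_cellSlope _ _) (hC.cellSlope_mem v N))
    (intervalIntegrable_of_mem_Icc (measurable_cellSlope _ _) (hC.cellSlope_mem w N)),
    integral_cellSlope _ hN, integral_cellSlope _ hN]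
  simp [copulaSection, hC.one_left, hC.zero_left]

/-- If the copulas `E n` approximate `C` uniformly with an error of smaller order than the bandwidth
`1 / N₁` then the partial derivatives of their induced checkerboards converge in `L¹`, and hence
their rearrangements converge pointwise. -/
theorem tendsto_siRearrangementFun_checkerboard {C : unitInterval → unitInterval → ℝ}
    (hC : IsCopula C) {E : ℕ → unitInterval → unitInterval → ℝ} {N₁ N₂ : ℕ → ℕ} {δ : ℕ → ℝ}
    (hN₁ : Tendsto N₁ atTop atTop) (hN₂ : Tendsto N₂ atTop atTop)
    (hE : ∀ᶠ n in atTop, IsCopula (E n))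
    (hδ : ∀ᶠ n in atTop, ∀ u v, |E n u v - C u v| ≤ δ n)
    (hNδ : Tendsto (fun n => N₁ n * δ n) atTop (𝓝 0)) (u v : unitInterval) :
    Tendsto (fun n => siRearrangementFun (checkerboard (inducedMatrix (N₁ n) (N₂ n) (E n))) u v)
      atTop (𝓝 (siRearrangementFun C u v)) := by
  have hlim : Tendsto (fun n => 2 * (1 / (N₂ n : ℝ)) + 2 * (N₁ n * δ n) +
      ∫ u in (0 : ℝ)..1, |cellSlope (copulaSection C v) (N₁ n) u - partialOne C v u|)
      atTop (𝓝 0) := by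
    have h1 := (tendsto_one_div_atTop_nhds_zero_nat (𝕜 := ℝ)).comp hN₂
    have h := ((h1.const_mul 2).add (hNδ.const_mul 2)).add
      (hC.tendsto_integral_abs_cellSlope_sub_partialOne v hN₁)
    simpa [Function.comp_def] using h
  rw [tendsto_iff_norm_sub_tendsto_zero]
  refine squeeze_zero' (Eventually.of_forall fun n => norm_nonneg _) ?_ hlim
  filter_upwards [hN₁.eventually_gt_atTop 0, hN₂.eventually_gt_atTop 0, hE, hδ]
    with n h₁ h₂ hEn hδn
  set D := checkerboard (inducedMatrix (N₁ n) (N₂ n) (E n)) with hD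
  have hDc : IsCopula D := isCopula_checkerboard h₁ h₂ (hEn.isCheckerboardMatrix h₁ h₂)
  have hp : (0 : ℝ) < N₂ n := by exact_mod_cast h₂
  -- `w` is the largest grid point below `v`; there `D` and `E n` can be compared.
  have hjN : ⌊(v : ℝ) * N₂ n⌋₊ ≤ N₂ n := by
    refine Nat.floor_le_of_le ?_
    nlinarith [v.2.2]
  set w : unitInterval :=
    gridPoint (⟨⌊(v : ℝ) * N₂ n⌋₊, Nat.lt_succ_of_le hjN⟩ : Fin (N₂ n + 1)) with hw
  have hwv := mem_Ico_floor_mul h₂ v.2.1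
  have hw1 : w ≤ v := hwv.1
  have hw2 : (v : ℝ) - w ≤ 1 / N₂ n := by
    have := hwv.2
    rw [add_div] at this
    have hwe : (w : ℝ) = (⌊(v : ℝ) * N₂ n⌋₊ : ℝ) / N₂ n := rfl
    linarith
  have mD : Measurable (partialOne D w) := measurable_deriv _
  have mC : Measurable (partialOne C v) := measurable_deriv _
  have s1 : |siRearrangementFun D u v - siRearrangementFun D u w| ≤ 1 / N₂ n := by
    have h := hDc.isCopula_siRearrangementFun.abs_sub_le u u v w
    rw [sub_self, abs_zero, zero_add, abs_of_nonneg (sub_nonneg.2 (Subtype.coe_le_coe.2 hw1))] at h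
    exact h.trans hw2
  have s2 : |siRearrangementFun D u w - siRearrangementFun C u v| ≤
      ∫ s in (0 : ℝ)..1, |partialOne D w s - partialOne C v s| :=
    abs_integral_decreasingRearrangement_sub_le mD mC (hDc.partialOne_nonneg w)
      (hDc.partialOne_le_one w) (hC.partialOne_nonneg v) (hC.partialOne_le_one v) u.2
  have iC := intervalIntegrable_of_mem_Icc mC
    fun s => ⟨hC.partialOne_nonneg v s, hC.partialOne_le_one v s⟩
  have iD := intervalIntegrable_of_mem_Icc mD
    fun s => ⟨hDc.partialOne_nonneg w s, hDc.partialOne_le_one w s⟩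
  have iw := intervalIntegrable_of_mem_Icc (measurable_cellSlope _ _) (hC.cellSlope_mem w (N₁ n))
  have iv := intervalIntegrable_of_mem_Icc (measurable_cellSlope _ _) (hC.cellSlope_mem v (N₁ n))
  have grid : ∀ k : ℕ, k ≤ N₁ n →
      |copulaSection D w ((k : ℝ) / N₁ n) - copulaSection C w ((k : ℝ) / N₁ n)| ≤ δ n := by
    intro k hk
    rw [copulaSection_grid D w hk, copulaSection_grid C w hk, hD, hw,
      checkerboard_inducedMatrix_grid h₁ h₂ hEn]
    exact hδn _ _
  have s3 : ∫ s in (0 : ℝ)..1, |partialOne D w s - partialOne C v s| ≤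
      ∫ s in (0 : ℝ)..1, (N₁ n * (2 * δ n) +
        |cellSlope (copulaSection C w) (N₁ n) s - cellSlope (copulaSection C v) (N₁ n) s| +
        |cellSlope (copulaSection C v) (N₁ n) s - partialOne C v s|) := by
    refine intervalIntegral.integral_mono_ae_restrict zero_le_one (iD.sub iC).abs
      ((intervalIntegrable_const.add (iw.sub iv).abs).add (iv.sub iC).abs) ?_
    rw [Filter.EventuallyLE, ae_restrict_iff' measurableSet_Icc]
    have n0 : ∀ᵐ s : ℝ, s ≠ 0 := by simp [ae_iff]
    have n1 : ∀ᵐ s : ℝ, s ≠ 1 := by simp [ae_iff]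
    filter_upwards [ae_partialOne_checkerboard h₁ (inducedMatrix (N₁ n) (N₂ n) (E n)) w, n0, n1]
      with s hs h0 h1 hs01
    have hs' : s ∈ Ioo (0 : ℝ) 1 := ⟨lt_of_le_of_ne hs01.1 h0.symm, lt_of_le_of_ne hs01.2 h1⟩
    rw [← hD] at hs
    have hb := abs_cellSlope_sub_le h₁ grid (Ioo_subset_Ico_self hs')
    rw [← hs hs'] at hb
    have t1 := _root_.abs_sub_le (partialOne D w s) (cellSlope (copulaSection C w) (N₁ n) s)
      (partialOne C v s)
    have t2 := _root_.abs_sub_le (cellSlope (copulaSection C w) (N₁ n) s)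
      (cellSlope (copulaSection C v) (N₁ n) s) (partialOne C v s)
    linarith
  rw [intervalIntegral.integral_add (intervalIntegrable_const.add (iw.sub iv).abs) (iv.sub iC).abs,
    intervalIntegral.integral_add intervalIntegrable_const (iw.sub iv).abs,
    hC.integral_abs_cellSlope_sub hw1 h₁, intervalIntegral.integral_const] at s3
  simp only [sub_zero, one_smul] at s3
  rw [Real.norm_eq_abs]
  have t := _root_.abs_sub_le (siRearrangementFun D u v) (siRearrangementFun D u w)
    (siRearrangementFun C u v)
  linarith

/-! ### Ranks and the empirical distribution function -/

open Classical in
/-- The joint empirical distribution function of the sample `(x 0, y 0), …, (x (n-1), y (n-1))`. -/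
noncomputable def empiricalCdf {n : ℕ} (x y : Fin n → ℝ) (s t : ℝ) : ℝ :=
  (∑ k : Fin n, if x k ≤ s ∧ y k ≤ t then (1 : ℝ) else 0) / n

theorem empiricalCdf_mono {n : ℕ} (x y : Fin n → ℝ) {s s' t t' : ℝ} (hs : s ≤ s') (ht : t ≤ t') :
    empiricalCdf x y s t ≤ empiricalCdf x y s' t' := by
  classical
  unfold empiricalCdf
  gcongr with k
  split_ifs with h1 h2 h2
  · exact le_rfl
  · exact absurd ⟨h1.1.trans hs, h1.2.trans ht⟩ h2
  · exact zero_le_one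
  · exact le_rfl

theorem sampleRank_pos {n : ℕ} (x : Fin n → ℝ) (k : Fin n) : 0 < sampleRank x k :=
  (Set.ncard_pos (Set.toFinite _)).2 ⟨k, (le_refl (x k) : x k ≤ x k)⟩

theorem sampleRank_le {n : ℕ} (x : Fin n → ℝ) (k : Fin n) : sampleRank x k ≤ n := by
  have h := Set.ncard_le_ncard (Set.subset_univ {j : Fin n | x j ≤ x k}) (Set.toFinite _)
  rwa [Set.ncard_univ, Nat.card_fin] at h

theorem sampleRank_le_sampleRank_iff {n : ℕ} (x : Fin n → ℝ) (k l : Fin n) :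
    sampleRank x k ≤ sampleRank x l ↔ x k ≤ x l := by
  refine ⟨fun h => ?_, fun h => Set.ncard_le_ncard (fun j (hj : x j ≤ x k) => hj.trans h)
    (Set.toFinite _)⟩
  by_contra! hlt
  refine absurd h (not_le.2 (Set.ncard_lt_ncard
    ⟨fun j (hj : x j ≤ x l) => (hj.trans hlt.le : x j ≤ x k), fun hh => ?_⟩ (Set.toFinite _)))
  exact absurd (hh (le_refl (x k) : x k ≤ x k) : x k ≤ x l) (not_le.2 hlt)

theorem sampleRank_comp_monotone {n : ℕ} {x : Fin n → ℝ} {f : ℝ → ℝ} (hf : Monotone f)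
    (hinj : Function.Injective fun k => f (x k)) :
    sampleRank (fun k => f (x k)) = sampleRank x := by
  funext k
  unfold sampleRank
  congr 1
  ext j
  refine ⟨fun h => show x j ≤ x k from ?_, fun h => hf h⟩
  by_contra! hlt
  have e : f (x j) = f (x k) := le_antisymm h (hf hlt.le)
  have : j = k := hinj e
  exact absurd hlt (by rw [this]; exact lt_irrefl _)

/-- The empirical checkerboard is unchanged under increasing transformations of the margins, as long
as these create no ties. -/
theorem empiricalCheckerboard_comp_monotone {n : ℕ} (N₁ N₂ : ℕ) {x y : Fin n → ℝ} {f g : ℝ → ℝ}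
    (hf : Monotone f) (hg : Monotone g) (hx : Function.Injective fun k => f (x k))
    (hy : Function.Injective fun k => g (y k)) :
    empiricalCheckerboard N₁ N₂ (fun k => f (x k)) (fun k => g (y k)) =
      empiricalCheckerboard N₁ N₂ x y := by
  simp only [empiricalCheckerboard, rankMatrix, sampleRank_comp_monotone hf hx,
    sampleRank_comp_monotone hg hy]

open Classical in
/-- At the grid points the empirical copula is the joint empirical distribution function of the
ranks. -/
theorem checkerboard_rankMatrix_grid {n : ℕ} {x y : Fin n → ℝ} (hx : Function.Injective x)
    (i j : Fin (n + 1)) :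
    checkerboard ((n : ℝ) • rankMatrix x y) (gridPoint i) (gridPoint j) =
      (∑ k : Fin n, if sampleRank x k ≤ i ∧ sampleRank y k ≤ j then (1 : ℝ) else 0) / n := by
  rcases n.eq_zero_or_pos with rfl | hn
  · rw [checkerboard_grid]; simp
  have hp : (0 : ℝ) < n := by exact_mod_cast hn
  -- the zero-based positions of the observations in the rank matrix
  let a : Fin n → Fin n := fun k =>
    ⟨sampleRank x k - 1, by have := sampleRank_pos x k; have := sampleRank_le x k; omega⟩
  let b : Fin n → Fin n := fun k =>
    ⟨sampleRank y k - 1, by have := sampleRank_pos y k; have := sampleRank_le y k; omega⟩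
  have ha : ∀ k (p : Fin n), sampleRank x k = (p : ℕ) + 1 ↔ p = a k := fun k p => by
    have := sampleRank_pos x k
    rw [Fin.ext_iff]; simp only [a]; omega
  have hb : ∀ k (p : Fin n), sampleRank y k = (p : ℕ) + 1 ↔ p = b k := fun k p => by
    have := sampleRank_pos y k
    rw [Fin.ext_iff]; simp only [b]; omega
  have hA : ∀ p q, rankMatrix x y p q = ∑ k, if p = a k ∧ q = b k then (1 : ℝ) else 0 := by
    intro p q
    simp only [rankMatrix, Matrix.of_apply, ha, hb]
    split_ifs with h
    · obtain ⟨k, hk⟩ := h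
      rw [Finset.sum_eq_single k, if_pos hk]
      · intro l _ hl
        rw [if_neg]
        rintro ⟨h1, -⟩
        exact hl ((sampleRank_bij hx p).unique ((ha l p).2 h1) ((ha k p).2 hk.1))
      · simp
    · rw [Finset.sum_eq_zero]
      intro k _
      rw [if_neg fun hk => h ⟨k, hk⟩]
  have hsum : ∀ p q : Fin n, (if (p : ℕ) < i ∧ (q : ℕ) < j then ((n : ℝ) • rankMatrix x y) p q
      else 0) = ∑ k, if p = a k then (if q = b k then
        (if (a k : ℕ) < i ∧ (b k : ℕ) < j then (n : ℝ) else 0) else 0) else 0 := by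
    intro p q
    rw [Matrix.smul_apply, hA, smul_eq_mul, Finset.mul_sum]
    by_cases hpq : (p : ℕ) < i ∧ (q : ℕ) < j
    · rw [if_pos hpq]
      refine Finset.sum_congr rfl fun k _ => ?_
      by_cases h1 : p = a k
      · by_cases h2 : q = b k
        · subst h1; subst h2; simp [hpq]
        · simp [h2]
      · simp [h1]
    · rw [if_neg hpq, Finset.sum_eq_zero]
      intro k _
      by_cases h1 : p = a k
      · by_cases h2 : q = b k
        · subst h1; subst h2; simp only [if_true, if_neg hpq]
        · simp [h2]
      · simp [h1]
  rw [checkerboard_grid]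
  simp only [hsum]
  have hswap : ∑ p : Fin n, ∑ q : Fin n, ∑ k, (if p = a k then (if q = b k then
        (if (a k : ℕ) < i ∧ (b k : ℕ) < j then (n : ℝ) else 0) else 0) else 0) =
      ∑ k, if (a k : ℕ) < i ∧ (b k : ℕ) < j then (n : ℝ) else 0 := by
    have : ∀ p : Fin n, ∑ q : Fin n, ∑ k, (if p = a k then (if q = b k then
        (if (a k : ℕ) < i ∧ (b k : ℕ) < j then (n : ℝ) else 0) else 0) else 0) =
        ∑ k, if p = a k then (if (a k : ℕ) < i ∧ (b k : ℕ) < j then (n : ℝ) else 0) else 0 := by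
      intro p
      rw [Finset.sum_comm]
      refine Finset.sum_congr rfl fun k _ => ?_
      by_cases h : p = a k <;> simp [h]
    simp only [this]
    rw [Finset.sum_comm]
    simp
  rw [hswap, Finset.sum_div, Finset.sum_div]
  refine Finset.sum_congr rfl fun k _ => ?_
  have e1 : (a k : ℕ) < i ↔ sampleRank x k ≤ i := by
    have := sampleRank_pos x k; simp only [a]; omega
  have e2 : (b k : ℕ) < j ↔ sampleRank y k ≤ j := by
    have := sampleRank_pos y k; simp only [b]; omega
  simp only [e1, e2]
  split_ifs
  · field_simp
  · simp

/-- For a sample in the unit square without ties, the value of the empirical copula at a grid point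
is the value of the empirical distribution function at a pair of order statistics, and each of
these is close to its expected level because the margins of `C` are uniform. -/
theorem abs_checkerboard_rankMatrix_sub_le_grid {n : ℕ} {x y : Fin n → unitInterval}
    (hx : Function.Injective fun k => (x k : ℝ)) (hy : Function.Injective fun k => (y k : ℝ))
    {C : unitInterval → unitInterval → ℝ} (hC : IsCopula C) {ε : ℝ}
    (h : ∀ s t : unitInterval,
      |empiricalCdf (fun k => (x k : ℝ)) (fun k => (y k : ℝ)) s t - C s t| ≤ ε)
    (i j : Fin (n + 1)) :
    |checkerboard ((n : ℝ) • rankMatrix (fun k => (x k : ℝ)) (fun k => (y k : ℝ)))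
      (gridPoint i) (gridPoint j) - C (gridPoint i) (gridPoint j)| ≤ 3 * ε := by
  classical
  have hε : 0 ≤ ε := (abs_nonneg _).trans (h 0 0)
  have g0 : gridPoint (0 : Fin (n + 1)) = 0 := by ext; simp [gridPoint]
  have hrank : ∀ (z : Fin n → ℝ) (k : Fin n),
      (∑ l : Fin n, if z l ≤ z k then (1 : ℝ) else 0) = sampleRank z k := by
    intro z k
    rw [Finset.sum_boole, sampleRank, Set.ncard_eq_toFinset_card']
    congr 2
    ext l
    simp
  rw [checkerboard_rankMatrix_grid hx]
  rcases Fin.eq_zero_or_eq_succ i with rfl | ⟨i, rfl⟩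
  · rw [g0, hC.zero_left, Finset.sum_eq_zero]
    · simpa using hε
    · intro k _
      have := sampleRank_pos (fun k => (x k : ℝ)) k
      rw [if_neg]
      simp only [Fin.val_zero]
      omega
  rcases Fin.eq_zero_or_eq_succ j with rfl | ⟨j, rfl⟩
  · rw [g0, hC.zero_right, Finset.sum_eq_zero]
    · simpa using hε
    · intro k _
      have := sampleRank_pos (fun k => (y k : ℝ)) k
      rw [if_neg]
      simp only [Fin.val_zero]
      omega
  obtain ⟨k, hk, -⟩ := sampleRank_bij hx i
  obtain ⟨l, hl, -⟩ := sampleRank_bij hy j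
  have e : (∑ m : Fin n, if sampleRank (fun k => (x k : ℝ)) m ≤ i.succ ∧
      sampleRank (fun k => (y k : ℝ)) m ≤ j.succ then (1 : ℝ) else 0) / n =
      empiricalCdf (fun k => (x k : ℝ)) (fun k => (y k : ℝ)) (x k) (y l) := by
    rw [Fin.val_succ, Fin.val_succ, ← hk, ← hl, empiricalCdf]
    simp only [sampleRank_le_sampleRank_iff]
  have hxk := h (x k) 1
  have hyl := h 1 (y l)
  rw [hC.one_right, empiricalCdf] at hxk
  rw [hC.one_left, empiricalCdf] at hyl
  simp only [Icc.coe_one, (x _).2.2, (y _).2.2, and_true, true_and] at hxk hyl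
  rw [hrank (fun k => (x k : ℝ)) k, hk] at hxk
  rw [hrank (fun k => (y k : ℝ)) l, hl] at hyl
  have h1 := h (x k) (y l)
  have h2 := hC.abs_sub_le (x k) (gridPoint i.succ) (y l) (gridPoint j.succ)
  have e1 : (gridPoint i.succ : ℝ) = ((i : ℕ) + 1 : ℕ) / n := by simp [gridPoint]
  have e2 : (gridPoint j.succ : ℝ) = ((j : ℕ) + 1 : ℕ) / n := by simp [gridPoint]
  rw [e1, e2] at h2
  rw [e]
  rw [abs_sub_comm] at hxk hyl
  have h3 := _root_.abs_sub_le (empiricalCdf (fun k => (x k : ℝ)) (fun k => (y k : ℝ)) (x k) (y l))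
    (C (x k) (y l)) (C (gridPoint i.succ) (gridPoint j.succ))
  linarith

/-- Every point of the unit interval lies in some cell of the grid with `n` cells. -/
theorem exists_gridPoint_le_le {n : ℕ} (hn : 0 < n) (u : unitInterval) :
    ∃ k : Fin n, gridPoint k.castSucc ≤ u ∧ u ≤ gridPoint k.succ := by
  have hp : (0 : ℝ) < n := by exact_mod_cast hn
  rcases eq_or_lt_of_le u.2.2 with h | h
  · refine ⟨⟨n - 1, by omega⟩, ?_, ?_⟩
    · exact Subtype.coe_le_coe.1 ((gridPoint _).2.2.trans h.ge)
    · change (u : ℝ) ≤ ((n - 1 + 1 : ℕ) : ℝ) / n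
      rw [Nat.sub_add_cancel hn, div_self hp.ne']
      exact u.2.2
  · have hm := mem_Ico_floor_mul hn u.2.1
    have hj : ⌊(u : ℝ) * n⌋₊ < n := by
      have := hm.1.trans_lt h
      rw [div_lt_one hp] at this
      exact_mod_cast this
    refine ⟨⟨_, hj⟩, hm.1, ?_⟩
    have := hm.2.le
    change (u : ℝ) ≤ ((⌊(u : ℝ) * n⌋₊ + 1 : ℕ) : ℝ) / n
    push_cast
    exact this

theorem gridPoint_succ_eq {n : ℕ} (k : Fin n) :
    (gridPoint k.succ : ℝ) = gridPoint k.castSucc + 1 / n := by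
  simp [gridPoint]; ring

theorem abs_checkerboard_rankMatrix_sub_le {n : ℕ} (hn : 0 < n) {x y : Fin n → unitInterval}
    (hx : Function.Injective fun k => (x k : ℝ)) (hy : Function.Injective fun k => (y k : ℝ))
    {C : unitInterval → unitInterval → ℝ} (hC : IsCopula C) {ε : ℝ}
    (h : ∀ s t : unitInterval,
      |empiricalCdf (fun k => (x k : ℝ)) (fun k => (y k : ℝ)) s t - C s t| ≤ ε)
    (u v : unitInterval) :
    |checkerboard ((n : ℝ) • rankMatrix (fun k => (x k : ℝ)) (fun k => (y k : ℝ))) u v - C u v| ≤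
      3 * ε + 4 / n := by
  have hE := isCopula_checkerboard hn hn (isCheckerboardMatrix_rankMatrix hx hy)
  set E := checkerboard ((n : ℝ) • rankMatrix (fun k => (x k : ℝ)) (fun k => (y k : ℝ)))
  obtain ⟨k, hk1, hk2⟩ := exists_gridPoint_le_le hn u
  obtain ⟨l, hl1, hl2⟩ := exists_gridPoint_le_le hn v
  have hk1' : (gridPoint k.castSucc : ℝ) ≤ u := hk1
  have hl1' : (gridPoint l.castSucc : ℝ) ≤ v := hl1
  have hk2' : (u : ℝ) ≤ gridPoint k.succ := hk2
  have hl2' : (v : ℝ) ≤ gridPoint l.succ := hl2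
  rw [gridPoint_succ_eq] at hk2' hl2'
  have h1 := abs_checkerboard_rankMatrix_sub_le_grid hx hy hC h k.castSucc l.castSucc
  have h2 := hE.abs_sub_le u (gridPoint k.castSucc) v (gridPoint l.castSucc)
  have h3 := hC.abs_sub_le u (gridPoint k.castSucc) v (gridPoint l.castSucc)
  rw [abs_of_nonneg (sub_nonneg.2 hk1'), abs_of_nonneg (sub_nonneg.2 hl1')] at h2 h3
  have e : (4 : ℝ) / n = 4 * (1 / n) := by ring
  rw [e]
  rw [abs_le] at *
  constructor <;> linarith

/-- A uniform bound for an empirical distribution function on the unit square follows from bounds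
at the grid points, both functions being monotone and `C` Lipschitz. -/
theorem abs_empiricalCdf_sub_le {n m : ℕ} (hm : 0 < m) (x y : Fin n → ℝ)
    {C : unitInterval → unitInterval → ℝ} (hC : IsCopula C) {ε : ℝ}
    (h : ∀ i j : Fin (m + 1), |empiricalCdf x y (gridPoint i) (gridPoint j) -
      C (gridPoint i) (gridPoint j)| ≤ ε) (s t : unitInterval) :
    |empiricalCdf x y s t - C s t| ≤ ε + 2 / m := by
  obtain ⟨k, hk1, hk2⟩ := exists_gridPoint_le_le hm s
  obtain ⟨l, hl1, hl2⟩ := exists_gridPoint_le_le hm t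
  have hk1' : (gridPoint k.castSucc : ℝ) ≤ s := hk1
  have hl1' : (gridPoint l.castSucc : ℝ) ≤ t := hl1
  have hk2' : (s : ℝ) ≤ gridPoint k.succ := hk2
  have hl2' : (t : ℝ) ≤ gridPoint l.succ := hl2
  have a1 := h k.castSucc l.castSucc
  have a2 := h k.succ l.succ
  have b1 := empiricalCdf_mono x y hk1' hl1'
  have b2 := empiricalCdf_mono x y hk2' hl2'
  have c1 := hC.abs_sub_le s (gridPoint k.castSucc) t (gridPoint l.castSucc)
  have c2 := hC.abs_sub_le s (gridPoint k.succ) t (gridPoint l.succ)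
  rw [abs_of_nonneg (sub_nonneg.2 hk1'), abs_of_nonneg (sub_nonneg.2 hl1')] at c1
  rw [abs_of_nonpos (sub_nonpos.2 hk2'), abs_of_nonpos (sub_nonpos.2 hl2')] at c2
  rw [gridPoint_succ_eq k] at hk2'
  rw [gridPoint_succ_eq l] at hl2'
  have g1 := gridPoint_succ_eq k
  have g2 := gridPoint_succ_eq l
  have e : (2 : ℝ) / m = 2 * (1 / m) := by ring
  rw [e]
  rw [abs_le] at *
  constructor <;> linarith

/-! ### The probability integral transform -/

theorem jointCdf_le_cdf_fst (ρ : Measure (ℝ × ℝ)) [IsProbabilityMeasure ρ] (x y : ℝ) :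
    jointCdf ρ x y ≤ cdf (ρ.map Prod.fst) x ∧
      cdf (ρ.map Prod.fst) x ≤ jointCdf ρ x y + (1 - cdf (ρ.map Prod.snd) y) := by
  have : IsProbabilityMeasure (ρ.map Prod.fst) :=
    Measure.isProbabilityMeasure_map measurable_fst.aemeasurable
  have : IsProbabilityMeasure (ρ.map Prod.snd) :=
    Measure.isProbabilityMeasure_map measurable_snd.aemeasurable
  rw [cdf_eq_real, cdf_eq_real, map_measureReal_apply measurable_fst measurableSet_Iic,
    map_measureReal_apply measurable_snd measurableSet_Iic,
    ← probReal_compl_eq_one_sub (measurable_snd measurableSet_Iic), jointCdf]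
  refine ⟨measureReal_mono fun p hp => hp.1, ?_⟩
  refine (measureReal_mono fun p hp => ?_).trans (measureReal_union_le _ _)
  by_cases h : p.2 ≤ y
  · exact Or.inl ⟨hp, h⟩
  · exact Or.inr h

/-- The marginal distribution function is the uniform limit of the sections of the joint one, hence
continuous. -/
theorem continuous_cdf_map_fst {ρ : Measure (ℝ × ℝ)} [IsProbabilityMeasure ρ]
    (hρ : Continuous fun p : ℝ × ℝ => jointCdf ρ p.1 p.2) :
    Continuous (cdf (ρ.map Prod.fst)) := by
  have : TendstoUniformly (fun (y x : ℝ) => jointCdf ρ x y) (cdf (ρ.map Prod.fst)) atTop := by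
    rw [Metric.tendstoUniformly_iff]
    intro ε hε
    have h := tendsto_cdf_atTop (ρ.map Prod.snd)
    filter_upwards [h.eventually_const_lt (by linarith : 1 - ε < 1)] with y hy x
    have := jointCdf_le_cdf_fst ρ x y
    rw [Real.dist_eq, abs_lt]
    constructor <;> linarith [this.1, this.2]
  refine this.continuous (Eventually.of_forall fun y => ?_).frequently
  exact hρ.comp (continuous_id.prodMk continuous_const)

theorem jointCdf_map_swap (ρ : Measure (ℝ × ℝ)) (x y : ℝ) :
    jointCdf (ρ.map Prod.swap) x y = jointCdf ρ y x := by
  rw [jointCdf, jointCdf, map_measureReal_apply measurable_swap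
    (measurableSet_Iic.prod measurableSet_Iic), preimage_swap_prod]

theorem continuous_cdf_map_snd {ρ : Measure (ℝ × ℝ)} [IsProbabilityMeasure ρ]
    (hρ : Continuous fun p : ℝ × ℝ => jointCdf ρ p.1 p.2) :
    Continuous (cdf (ρ.map Prod.snd)) := by
  have : IsProbabilityMeasure (ρ.map Prod.swap) :=
    Measure.isProbabilityMeasure_map measurable_swap.aemeasurable
  have h : Continuous fun p : ℝ × ℝ => jointCdf (ρ.map Prod.swap) p.1 p.2 := by
    simp only [jointCdf_map_swap]
    exact hρ.comp continuous_swap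
  have h2 := continuous_cdf_map_fst h
  rwa [Measure.map_map measurable_fst measurable_swap] at h2

/-- A continuous distribution function has, at each level in `(0,1)`, a largest quantile. -/
theorem exists_largest_quantile {ν : Measure ℝ} (hν : Continuous (cdf ν)) {s : ℝ}
    (hs : s ∈ Ioo (0 : ℝ) 1) : ∃ q, cdf ν q = s ∧ ∀ x, cdf ν x ≤ s ↔ x ≤ q := by
  obtain ⟨a, ha⟩ := ((tendsto_cdf_atBot ν).eventually_lt_const hs.1).exists
  obtain ⟨b, hb⟩ := ((tendsto_cdf_atTop ν).eventually_const_lt hs.2).exists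
  set S := {x | cdf ν x ≤ s}
  have hbdd : BddAbove S := ⟨b, fun x hx => by
    by_contra! h
    exact absurd (hb.trans_le (monotone_cdf ν h.le)) (not_lt.2 hx)⟩
  have hne : S.Nonempty := ⟨a, ha.le⟩
  have hmem : sSup S ∈ S := (isClosed_le hν continuous_const).csSup_mem hne hbdd
  have hab : a ≤ b := (monotone_cdf ν).reflect_lt (ha.trans hb) |>.le
  obtain ⟨c, -, hc⟩ := intermediate_value_Icc hab hν.continuousOn ⟨ha.le, hb.le⟩
  refine ⟨sSup S, le_antisymm hmem ?_, fun x => ⟨fun h => le_csSup hbdd h, fun h => ?_⟩⟩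
  · rw [← hc]
    exact monotone_cdf ν (le_csSup hbdd hc.le)
  · exact (monotone_cdf ν h).trans hmem

/-- The probability integral transform of a law with continuous distribution function is uniformly
distributed on the unit interval. -/
theorem measureReal_cdf_le {ν : Measure ℝ} [IsProbabilityMeasure ν] (hν : Continuous (cdf ν))
    {s : ℝ} (hs : s ∈ Icc (0 : ℝ) 1) : ν.real {x | cdf ν x ≤ s} = s := by
  have inner : ∀ s ∈ Ioo (0 : ℝ) 1, ν.real {x | cdf ν x ≤ s} = s := by
    intro s hs
    obtain ⟨q, hq, h⟩ := exists_largest_quantile hν hs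
    have e : {x | cdf ν x ≤ s} = Iic q := by ext x; exact h x
    rw [e, ← cdf_eq_real, hq]
  rcases eq_or_lt_of_le hs.1 with rfl | h0
  · refine le_antisymm (le_of_forall_gt_imp_ge_of_dense fun ε hε => ?_) measureReal_nonneg
    have hm : min ε (1 / 2) ∈ Ioo (0 : ℝ) 1 :=
      ⟨lt_min hε (by norm_num), (min_le_right _ _).trans_lt (by norm_num)⟩
    calc ν.real {x | cdf ν x ≤ 0} ≤ ν.real {x | cdf ν x ≤ min ε (1 / 2)} :=
          measureReal_mono fun x (hx : cdf ν x ≤ 0) => hx.trans hm.1.le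
      _ ≤ ε := by rw [inner _ hm]; exact min_le_left _ _
  rcases eq_or_lt_of_le hs.2 with rfl | h1
  · have e : {x | cdf ν x ≤ 1} = univ := by ext x; simp [cdf_le_one]
    rw [e, probReal_univ]
  · exact inner s ⟨h0, h1⟩

theorem map_cdf_singleton {ν : Measure ℝ} [IsProbabilityMeasure ν]
    (hν : Continuous (cdf ν)) (s : ℝ) : (ν.map (cdf ν)) {s} = 0 := by
  have hm : Measurable (cdf ν) := (monotone_cdf ν).measurable
  have hp : IsProbabilityMeasure (ν.map (cdf ν)) := Measure.isProbabilityMeasure_map hm.aemeasurable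
  by_cases hs : s ∈ Icc (0 : ℝ) 1
  · rw [← measureReal_eq_zero_iff, map_measureReal_apply hm (measurableSet_singleton s)]
    refine le_antisymm (le_of_forall_gt_imp_ge_of_dense fun ε hε => ?_) measureReal_nonneg
    rcases eq_or_lt_of_le hs.1 with rfl | h0
    · refine le_trans ?_ hε.le
      refine (measureReal_mono (s₂ := {x | cdf ν x ≤ 0}) fun x (hx : cdf ν x = 0) => hx.le).trans ?_
      exact (measureReal_cdf_le hν hs).le
    · have ht : max 0 (s - ε) ∈ Icc (0 : ℝ) 1 :=
        ⟨le_max_left _ _, max_le zero_le_one (by linarith [hs.2])⟩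
      have hts : max 0 (s - ε) < s := max_lt h0 (by linarith)
      have hsub : cdf ν ⁻¹' {s} ⊆ {x | cdf ν x ≤ s} \ {x | cdf ν x ≤ max 0 (s - ε)} := by
        intro x (hx : cdf ν x = s)
        exact ⟨hx.le, fun h => absurd (hx ▸ h : s ≤ _) (not_le.2 hts)⟩
      refine (measureReal_mono hsub).trans ?_
      have hss : {x | cdf ν x ≤ max 0 (s - ε)} ⊆ {x | cdf ν x ≤ s} :=
        fun x (hx : cdf ν x ≤ _) => hx.trans hts.le
      rw [measureReal_sdiff hss (measurableSet_le hm measurable_const),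
        measureReal_cdf_le hν hs, measureReal_cdf_le hν ht]
      linarith [le_max_right 0 (s - ε)]
  · rw [Measure.map_apply hm (measurableSet_singleton s)]
    have : cdf ν ⁻¹' {s} = ∅ := by
      ext x
      simp only [mem_preimage, mem_singleton_iff, mem_empty_iff_false, iff_false]
      rintro rfl
      exact hs ⟨cdf_nonneg _ _, cdf_le_one _ _⟩
    rw [this, measure_empty]

/-- The copula of a law with continuous margins is the joint distribution function of the
probability integral transforms of the margins. -/
theorem measureReal_cdf_le_and_cdf_le {ρ : Measure (ℝ × ℝ)} [IsProbabilityMeasure ρ]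
    (hρ : Continuous fun p : ℝ × ℝ => jointCdf ρ p.1 p.2) {C : Copula} (hC : IsCopulaOf C ρ)
    (s t : unitInterval) :
    ρ.real {p | cdf (ρ.map Prod.fst) p.1 ≤ s ∧ cdf (ρ.map Prod.snd) p.2 ≤ t} = C.1 s t := by
  have p1 : IsProbabilityMeasure (ρ.map Prod.fst) :=
    Measure.isProbabilityMeasure_map measurable_fst.aemeasurable
  have p2 : IsProbabilityMeasure (ρ.map Prod.snd) :=
    Measure.isProbabilityMeasure_map measurable_snd.aemeasurable
  have c1 := continuous_cdf_map_fst hρ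
  have c2 := continuous_cdf_map_snd hρ
  have u1 := measureReal_cdf_le c1 s.2
  have u2 := measureReal_cdf_le c2 t.2
  rw [map_measureReal_apply measurable_fst (measurableSet_le (monotone_cdf _).measurable
    measurable_const)] at u1
  rw [map_measureReal_apply measurable_snd (measurableSet_le (monotone_cdf _).measurable
    measurable_const)] at u2
  set F := cdf (ρ.map Prod.fst) with hF
  set G := cdf (ρ.map Prod.snd) with hG
  rcases eq_or_lt_of_le s.2.1 with hs0 | hs0
  · have : s = 0 := Subtype.ext hs0.symm
    subst this
    rw [C.2.zero_left]
    refine le_antisymm ?_ measureReal_nonneg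
    exact (measureReal_mono fun p hp => hp.1).trans u1.le
  rcases eq_or_lt_of_le t.2.1 with ht0 | ht0
  · have : t = 0 := Subtype.ext ht0.symm
    subst this
    rw [C.2.zero_right]
    refine le_antisymm ?_ measureReal_nonneg
    exact (measureReal_mono fun p hp => hp.2).trans u2.le
  rcases eq_or_lt_of_le s.2.2 with hs1 | hs1
  · have : s = 1 := Subtype.ext hs1
    subst this
    rw [C.2.one_left]
    refine Eq.trans ?_ u2
    congr 1
    ext p
    simp [hF, cdf_le_one]
  rcases eq_or_lt_of_le t.2.2 with ht1 | ht1
  · have : t = 1 := Subtype.ext ht1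
    subst this
    rw [C.2.one_right]
    refine Eq.trans ?_ u1
    congr 1
    ext p
    simp [hG, cdf_le_one]
  obtain ⟨q, hq, hq'⟩ := exists_largest_quantile c1 ⟨hs0, hs1⟩
  obtain ⟨r, hr, hr'⟩ := exists_largest_quantile c2 ⟨ht0, ht1⟩
  have e : {p : ℝ × ℝ | F p.1 ≤ s ∧ G p.2 ≤ t} = Iic q ×ˢ Iic r := by
    ext p
    exact and_congr (hq' p.1) (hr' p.2)
  have e1 : cdfUnit (ρ.map Prod.fst) q = s := Subtype.ext hq
  have e2 : cdfUnit (ρ.map Prod.snd) r = t := Subtype.ext hr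
  rw [e, ← e1, ← e2, hC]
  rfl

theorem ae_ne_of_indepFun {Ω : Type*} [MeasurableSpace Ω] {P : Measure Ω} [IsProbabilityMeasure P]
    {U V : Ω → ℝ} (hU : AEMeasurable U P) (hV : AEMeasurable V P) (h : IndepFun U V P)
    (hatom : ∀ s, (P.map V) {s} = 0) : ∀ᵐ ω ∂P, U ω ≠ V ω := by
  have hm : MeasurableSet {p : ℝ × ℝ | p.1 = p.2} := measurableSet_eq_fun measurable_fst
    measurable_snd
  have hz : (P.map fun ω => (U ω, V ω)) {p : ℝ × ℝ | p.1 = p.2} = 0 := by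
    have : IsProbabilityMeasure (P.map V) := Measure.isProbabilityMeasure_map hV
    rw [(indepFun_iff_map_prod_eq_prod_map_map hU hV).1 h, Measure.measure_prod_null hm]
    refine Eventually.of_forall fun x => ?_
    have : Prod.mk x ⁻¹' {p : ℝ × ℝ | p.1 = p.2} = {x} := by ext y; simp [eq_comm]
    simp only [this, Pi.zero_apply, hatom]
  rw [Measure.map_apply_of_aemeasurable (hU.prodMk hV) hm] at hz
  rw [ae_iff]
  simpa using hz

/-! ### Uniform rate of convergence of the empirical distribution function -/

/-- Hoeffding's inequality for the relative frequency of an event. -/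
theorem measureReal_abs_frequency_sub_ge_le {Ω 𝓧 : Type*} [MeasurableSpace Ω] [MeasurableSpace 𝓧]
    {P : Measure Ω} [IsProbabilityMeasure P] {ρ : Measure 𝓧} {Z : ℕ → Ω → 𝓧}
    (hlaw : ∀ i, HasLaw (Z i) ρ P) (hindep : iIndepFun Z P) {B : Set 𝓧} (hB : MeasurableSet B)
    {n : ℕ} (hn : 0 < n) {ε : ℝ} (hε : 0 ≤ ε) :
    P.real {ω | ε ≤ |(∑ i ∈ Finset.range n, B.indicator (fun _ => (1 : ℝ)) (Z i ω)) / n -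
      ρ.real B|} ≤ 2 * Real.exp (-(2 * n * ε ^ 2)) := by
  have hp : (0 : ℝ) < n := by exact_mod_cast hn
  have hBm : Measurable (B.indicator fun _ => (1 : ℝ)) := measurable_const.indicator hB
  have hW : ∀ i, AEMeasurable (fun ω => B.indicator (fun _ => (1 : ℝ)) (Z i ω)) P := fun i =>
    hBm.comp_aemeasurable (hlaw i).aemeasurable
  have hE : ∀ i, ∫ ω, B.indicator (fun _ => (1 : ℝ)) (Z i ω) ∂P = ρ.real B := by
    intro i
    have h := (hlaw i).integral_comp (f := B.indicator fun _ => (1 : ℝ)) (by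
      rw [(hlaw i).map_eq.symm]; exact hBm.aestronglyMeasurable)
    rw [Function.comp_def] at h
    rw [h, integral_indicator_const _ hB, smul_eq_mul, mul_one]
  have hsub : ∀ i, HasSubgaussianMGF
      (fun ω => B.indicator (fun _ => (1 : ℝ)) (Z i ω) - ρ.real B) ((‖(1 : ℝ) - 0‖₊ / 2) ^ 2) P := by
    intro i
    have h := hasSubgaussianMGF_of_mem_Icc (a := 0) (b := 1) (hW i) (ae_of_all _ fun ω => by
      by_cases hz : Z i ω ∈ B <;> simp [hz])
    rwa [hE i] at h
  have hind : iIndepFun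
      (fun i ω => B.indicator (fun _ => (1 : ℝ)) (Z i ω) - ρ.real B) P :=
    hindep.comp (fun _ z => B.indicator (fun _ => (1 : ℝ)) z - ρ.real B)
      fun _ => hBm.sub_const _
  have hind' : iIndepFun
      (fun i ω => -(B.indicator (fun _ => (1 : ℝ)) (Z i ω) - ρ.real B)) P :=
    hindep.comp (fun _ z => -(B.indicator (fun _ => (1 : ℝ)) z - ρ.real B))
      fun _ => (hBm.sub_const _).neg
  have hnε : 0 ≤ n * ε := by positivity
  have t1 := HasSubgaussianMGF.measure_sum_range_ge_le_of_iIndepFun hind (n := n)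
    (fun i _ => hsub i) hnε
  have t2 := HasSubgaussianMGF.measure_sum_range_ge_le_of_iIndepFun hind' (n := n)
    (fun i _ => (hsub i).neg) hnε
  have e : -(n * ε) ^ 2 / (2 * n * (((‖(1 : ℝ) - 0‖₊ / 2) ^ 2 : NNReal) : ℝ)) =
      -(2 * n * ε ^ 2) := by
    simp
    field_simp
  rw [e] at t1 t2
  calc P.real {ω | ε ≤ |(∑ i ∈ Finset.range n, B.indicator (fun _ => (1 : ℝ)) (Z i ω)) / n -
        ρ.real B|}
      ≤ P.real ({ω | n * ε ≤ ∑ i ∈ Finset.range n,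
          (B.indicator (fun _ => (1 : ℝ)) (Z i ω) - ρ.real B)} ∪
        {ω | n * ε ≤ ∑ i ∈ Finset.range n,
          -(B.indicator (fun _ => (1 : ℝ)) (Z i ω) - ρ.real B)}) := by
        refine measureReal_mono fun ω (hω : ε ≤ |_|) => ?_
        set S := ∑ i ∈ Finset.range n, B.indicator (fun _ => (1 : ℝ)) (Z i ω) with hS
        have e1 : ∑ i ∈ Finset.range n, (B.indicator (fun _ => (1 : ℝ)) (Z i ω) - ρ.real B) =
            n * (S / n - ρ.real B) := by
          rw [Finset.sum_sub_distrib, ← hS]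
          simp
          field_simp
        rcases le_abs.1 hω with h | h
        · refine Or.inl ?_
          change n * ε ≤ ∑ i ∈ Finset.range n, _
          rw [e1]
          gcongr
        · refine Or.inr ?_
          change n * ε ≤ ∑ i ∈ Finset.range n, _
          rw [Finset.sum_neg_distrib, e1, ← mul_neg]
          gcongr
    _ ≤ _ := measureReal_union_le _ _
    _ ≤ 2 * Real.exp (-(2 * n * ε ^ 2)) := by linarith

/-- The union bound over `(n+1)²` points keeps the stretched exponential tails summable. -/
theorem summable_sq_mul_exp_neg_rpow {a : ℝ} (ha : 0 < a) :
    Summable fun n : ℕ => ((n : ℝ) + 1) ^ 2 * (2 * Real.exp (-(2 * (n : ℝ) ^ a))) := by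
  have h1 : (fun x : ℝ => Real.exp (-2 * x)) =o[atTop] fun x => x ^ (-4 / a) :=
    isLittleO_exp_neg_mul_rpow_atTop two_pos _
  have h2 : Tendsto (fun n : ℕ => (n : ℝ) ^ a) atTop atTop :=
    (tendsto_rpow_atTop ha).comp tendsto_natCast_atTop_atTop
  have h3 := (h1.comp_tendsto h2).isBigO
  have h4 : (fun n : ℕ => ((n : ℝ) + 1) ^ 2 * 2) =O[atTop] fun n : ℕ => (n : ℝ) ^ 2 := by
    refine Asymptotics.IsBigO.of_bound 8 ?_
    filter_upwards [eventually_ge_atTop 1] with n hn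
    have hn' : (1 : ℝ) ≤ n := by exact_mod_cast hn
    rw [Real.norm_of_nonneg (by positivity), Real.norm_of_nonneg (by positivity)]
    nlinarith
  have h5 := h4.mul h3
  refine summable_of_isBigO_nat (g := fun n : ℕ => (1 : ℝ) / (n : ℝ) ^ 2)
    (Real.summable_one_div_nat_pow.2 one_lt_two) ?_
  refine (h5.congr_left fun n => ?_).congr' EventuallyEq.rfl ?_
  · simp only [Function.comp_apply]
    ring_nf
  · filter_upwards [eventually_gt_atTop 0] with n hn
    have hn' : (0 : ℝ) < n := by exact_mod_cast hn
    simp only [Function.comp_apply]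
    rw [← Real.rpow_mul hn'.le, mul_div_cancel₀ _ ha.ne', Real.rpow_neg hn'.le]
    norm_cast
    push_cast
    field_simp

/-- The joint empirical distribution function of the probability integral transforms converges to the
copula uniformly at the rate `n ^ (-s)`, for each `s < 1/2`. Hoeffding's inequality is applied
at the `(n+1)²` points of the grid of mesh `1/n`. -/
theorem ae_eventually_abs_empiricalCdf_sub_le {Ω : Type*} [MeasurableSpace Ω] {P : Measure Ω}
    [IsProbabilityMeasure P] {ρ : Measure (ℝ × ℝ)} [IsProbabilityMeasure ρ]
    (hρ : Continuous fun p : ℝ × ℝ => jointCdf ρ p.1 p.2) {C : Copula} (hC : IsCopulaOf C ρ)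
    {X Y : ℕ → Ω → ℝ} (hlaw : ∀ i, HasLaw (fun ω => (X i ω, Y i ω)) ρ P)
    (hindep : iIndepFun (fun i ω => (X i ω, Y i ω)) P) {s : ℝ} (hs : s < 1 / 2) :
    ∀ᵐ ω ∂P, ∀ᶠ n : ℕ in atTop, ∀ u v : unitInterval,
      |empiricalCdf (fun i : Fin n => cdf (ρ.map Prod.fst) (X i ω))
        (fun i : Fin n => cdf (ρ.map Prod.snd) (Y i ω)) u v - C.1 u v| ≤
      (n : ℝ) ^ (-s) + 2 / n := by
  classical
  set F := cdf (ρ.map Prod.fst) with hF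
  set G := cdf (ρ.map Prod.snd) with hG
  let bad : ℕ → Set Ω := fun n => ⋃ ij : Fin (n + 1) × Fin (n + 1),
    {ω | (n : ℝ) ^ (-s) ≤ |empiricalCdf (fun i : Fin n => F (X i ω)) (fun i : Fin n => G (Y i ω))
      (gridPoint ij.1) (gridPoint ij.2) - C.1 (gridPoint ij.1) (gridPoint ij.2)|}
  have hbad : ∀ n, P (bad n) ≤ ENNReal.ofReal
      (((n : ℝ) + 1) ^ 2 * (2 * Real.exp (-(2 * (n : ℝ) ^ (1 - 2 * s))))) := by
    intro n
    rcases n.eq_zero_or_pos with rfl | hn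
    · refine prob_le_one.trans ?_
      rw [CharP.cast_eq_zero, Real.zero_rpow (by linarith)]
      norm_num
    have hp : (0 : ℝ) < n := by exact_mod_cast hn
    have hpt : ∀ ij : Fin (n + 1) × Fin (n + 1), P.real {ω | (n : ℝ) ^ (-s) ≤
        |empiricalCdf (fun i : Fin n => F (X i ω)) (fun i : Fin n => G (Y i ω))
          (gridPoint ij.1) (gridPoint ij.2) - C.1 (gridPoint ij.1) (gridPoint ij.2)|} ≤
        2 * Real.exp (-(2 * (n : ℝ) ^ (1 - 2 * s))) := by
      intro ij
      have hB : MeasurableSet {p : ℝ × ℝ | F p.1 ≤ gridPoint ij.1 ∧ G p.2 ≤ gridPoint ij.2} :=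
        (measurableSet_le ((monotone_cdf _).measurable.comp measurable_fst)
          measurable_const).inter
        (measurableSet_le ((monotone_cdf _).measurable.comp measurable_snd) measurable_const)
      have h := measureReal_abs_frequency_sub_ge_le hlaw hindep hB hn
        (ε := (n : ℝ) ^ (-s)) (by positivity)
      rw [measureReal_cdf_le_and_cdf_le hρ hC] at h
      have e : (n : ℝ) * ((n : ℝ) ^ (-s)) ^ 2 = (n : ℝ) ^ (1 - 2 * s) := by
        rw [← Real.rpow_natCast, ← Real.rpow_mul hp.le, ← Real.rpow_one_add' hp.le]
        · congr 1; push_cast; ring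
        · push_cast; linarith
      rw [mul_assoc, e] at h
      convert h using 7 with ω
      rw [empiricalCdf, ← Fin.sum_univ_eq_sum_range
        (fun i => indicator {p : ℝ × ℝ | F p.1 ≤ gridPoint ij.1 ∧ G p.2 ≤ gridPoint ij.2}
          (fun _ => (1 : ℝ)) (X i ω, Y i ω))]
      simp only [indicator_apply, mem_ofPred_eq]
    rw [← ofReal_measureReal]
    refine ENNReal.ofReal_le_ofReal ?_
    refine (measureReal_iUnion_fintype_le _).trans ((Finset.sum_le_sum fun ij _ => hpt ij).trans ?_)
    rw [Finset.sum_const, Finset.card_univ, Fintype.card_prod, Fintype.card_fin, nsmul_eq_mul]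
    push_cast
    rw [sq]
  have hsum : ∑' n, P (bad n) ≠ ⊤ := by
    refine ne_top_of_le_ne_top ?_ (ENNReal.tsum_le_tsum hbad)
    exact (summable_sq_mul_exp_neg_rpow (by linarith)).tsum_ofReal_ne_top
  filter_upwards [ae_eventually_notMem hsum] with ω hω
  filter_upwards [hω, eventually_gt_atTop 0] with n hn hn0
  refine abs_empiricalCdf_sub_le hn0 _ _ C.2 fun i j => ?_
  by_contra! hlt
  exact hn (mem_iUnion.2 ⟨(i, j), hlt.le⟩)

theorem ae_injective_of_iIndepFun {Ω : Type*} [MeasurableSpace Ω] {P : Measure Ω}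
    [IsProbabilityMeasure P] {U : ℕ → Ω → ℝ} (hU : ∀ i, AEMeasurable (U i) P)
    (h : iIndepFun U P) (hatom : ∀ i s, (P.map (U i)) {s} = 0) :
    ∀ᵐ ω ∂P, Function.Injective fun i => U i ω := by
  have h2 : ∀ᵐ ω ∂P, ∀ i j, i ≠ j → U i ω ≠ U j ω := by
    refine ae_all_iff.2 fun i => ae_all_iff.2 fun j => ?_
    by_cases hij : i = j
    · exact Eventually.of_forall fun ω hne => absurd hij hne
    · filter_upwards [ae_ne_of_indepFun (hU i) (hU j) (h.indepFun hij) (hatom j)] with ω hω _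
      exact hω
  filter_upwards [h2] with ω hω i j hij
  by_contra hne
  exact hω i j hne hij

/-! ### Consistency of the rearranged estimate -/

theorem tendsto_floor_natCast_rpow {s : ℝ} (hs : 0 < s) :
    Tendsto (fun n : ℕ => ⌊(n : ℝ) ^ s⌋₊) atTop atTop :=
  tendsto_nat_floor_atTop.comp ((tendsto_rpow_atTop hs).comp tendsto_natCast_atTop_atTop)

theorem tendsto_floor_rpow_mul_rate {s₁ s : ℝ} (hs : s₁ < s) (hs1 : s < 1) :
    Tendsto (fun n : ℕ => (⌊(n : ℝ) ^ s₁⌋₊ : ℝ) * (3 * ((n : ℝ) ^ (-s) + 2 / n) + 4 / n))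
      atTop (𝓝 0) := by
  have h : Tendsto (fun n : ℕ => 13 * (n : ℝ) ^ (-(s - s₁))) atTop (𝓝 0) := by
    have := ((tendsto_rpow_neg_atTop (sub_pos.2 hs)).comp
      (tendsto_natCast_atTop_atTop (R := ℝ))).const_mul 13
    simpa [Function.comp_def] using this
  refine squeeze_zero' (Eventually.of_forall fun n => by positivity) ?_ h
  filter_upwards [eventually_ge_atTop 1] with n hn
  have hn' : (1 : ℝ) ≤ n := by exact_mod_cast hn
  have hp : (0 : ℝ) < n := by linarith
  have h1 : 1 / (n : ℝ) ≤ (n : ℝ) ^ (-s) := by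
    rw [one_div, ← Real.rpow_neg_one]
    exact Real.rpow_le_rpow_of_exponent_le hn' (by linarith)
  have e : (2 : ℝ) / n = 2 * (1 / n) := by ring
  have e' : (4 : ℝ) / n = 4 * (1 / n) := by ring
  -- `1 / n ≤ n ^ (-s)`, so the second factor is at most `(3 * (1 + 2) + 4) * n ^ (-s)`
  calc (⌊(n : ℝ) ^ s₁⌋₊ : ℝ) * (3 * ((n : ℝ) ^ (-s) + 2 / n) + 4 / n)
      ≤ (n : ℝ) ^ s₁ * (13 * (n : ℝ) ^ (-s)) := by
        gcongr
        · exact Nat.floor_le (by positivity)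
        · linarith
    _ = 13 * (n : ℝ) ^ (-(s - s₁)) := by
        rw [mul_left_comm, ← Real.rpow_add hp]
        ring_nf

/-- In a sample from a law with continuous margins there are almost surely no ties, even after the
probability integral transform. -/
theorem ae_injective_cdf {Ω : Type*} [MeasurableSpace Ω] {P : Measure Ω} [IsProbabilityMeasure P]
    {ν : Measure ℝ} [IsProbabilityMeasure ν] (hν : Continuous (cdf ν)) {X : ℕ → Ω → ℝ}
    (hlaw : ∀ i, HasLaw (X i) ν P) (hindep : iIndepFun X P) :
    ∀ᵐ ω ∂P, Function.Injective fun i => cdf ν (X i ω) := by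
  have hm : Measurable (cdf ν) := (monotone_cdf ν).measurable
  refine ae_injective_of_iIndepFun (fun i => hm.comp_aemeasurable (hlaw i).aemeasurable)
    (hindep.comp (fun _ => cdf ν) fun _ => hm) fun i s => ?_
  have e : P.map (fun ω => cdf ν (X i ω)) = ν.map (cdf ν) :=
    (HasLaw.comp (Y := cdf ν) (μ := ν) { map_eq := rfl, aemeasurable := hm.aemeasurable }
      (hlaw i)).map_eq
  exact e ▸ map_cdf_singleton hν s

/-- Almost surely the rearranged empirical checkerboard copulas are eventually defined and converge
pointwise to the rearrangement of `C`. -/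
theorem ae_tendsto_siRearrangementFun_empiricalCheckerboard {Ω : Type*} [MeasurableSpace Ω]
    {P : Measure Ω} [IsProbabilityMeasure P] {ρ : Measure (ℝ × ℝ)} [IsProbabilityMeasure ρ]
    (hρ : Continuous fun p : ℝ × ℝ => jointCdf ρ p.1 p.2) {C : Copula} (hC : IsCopulaOf C ρ)
    {X Y : ℕ → Ω → ℝ} (hlaw : ∀ i, HasLaw (fun ω => (X i ω, Y i ω)) ρ P)
    (hindep : iIndepFun (fun i ω => (X i ω, Y i ω)) P)
    {s₁ s₂ : ℝ} (hs₁ : s₁ ∈ Ioo (0 : ℝ) (1 / 2)) (hs₂ : 0 < s₂) :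
    ∀ᵐ ω ∂P,
      (∀ᶠ n : ℕ in atTop, IsCopula (empiricalCheckerboard ⌊(n : ℝ) ^ s₁⌋₊ ⌊(n : ℝ) ^ s₂⌋₊
        (fun i : Fin n => X i ω) (fun i : Fin n => Y i ω))) ∧
      ∀ u v, Tendsto (fun n : ℕ => siRearrangementFun (empiricalCheckerboard ⌊(n : ℝ) ^ s₁⌋₊
        ⌊(n : ℝ) ^ s₂⌋₊ (fun i : Fin n => X i ω) (fun i : Fin n => Y i ω)) u v) atTop
        (𝓝 (siRearrangementFun C.1 u v)) := by
  have p1 : IsProbabilityMeasure (ρ.map Prod.fst) :=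
    Measure.isProbabilityMeasure_map measurable_fst.aemeasurable
  have p2 : IsProbabilityMeasure (ρ.map Prod.snd) :=
    Measure.isProbabilityMeasure_map measurable_snd.aemeasurable
  obtain ⟨s, hs, hs'⟩ := exists_between hs₁.2
  have lawX : ∀ i, HasLaw (X i) (ρ.map Prod.fst) P := fun i =>
    HasLaw.comp (Y := Prod.fst) (μ := ρ)
      { map_eq := rfl, aemeasurable := measurable_fst.aemeasurable } (hlaw i)
  have lawY : ∀ i, HasLaw (Y i) (ρ.map Prod.snd) P := fun i =>
    HasLaw.comp (Y := Prod.snd) (μ := ρ)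
      { map_eq := rfl, aemeasurable := measurable_snd.aemeasurable } (hlaw i)
  have indX : iIndepFun X P := hindep.comp (fun _ => Prod.fst) fun _ => measurable_fst
  have indY : iIndepFun Y P := hindep.comp (fun _ => Prod.snd) fun _ => measurable_snd
  filter_upwards [ae_eventually_abs_empiricalCdf_sub_le hρ hC hlaw hindep hs',
    ae_injective_cdf (continuous_cdf_map_fst hρ) lawX indX,
    ae_injective_cdf (continuous_cdf_map_snd hρ) lawY indY] with ω hω hX hY
  -- the transformed sample, with the same ranks
  let U : ∀ n : ℕ, Fin n → unitInterval := fun n i => cdfUnit (ρ.map Prod.fst) (X i ω)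
  let V : ∀ n : ℕ, Fin n → unitInterval := fun n i => cdfUnit (ρ.map Prod.snd) (Y i ω)
  have hU : ∀ n, Function.Injective fun i => (U n i : ℝ) := fun n i j h => Fin.ext (hX h)
  have hV : ∀ n, Function.Injective fun i => (V n i : ℝ) := fun n i j h => Fin.ext (hY h)
  have he : ∀ n N₁ N₂ : ℕ, empiricalCheckerboard N₁ N₂ (fun i : Fin n => X i ω)
      (fun i : Fin n => Y i ω) = checkerboard (inducedMatrix N₁ N₂
        (checkerboard ((n : ℝ) • rankMatrix (fun i => (U n i : ℝ)) (fun i => (V n i : ℝ))))) :=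
    fun n N₁ N₂ => (empiricalCheckerboard_comp_monotone N₁ N₂ (monotone_cdf _) (monotone_cdf _)
      (hU n) (hV n)).symm
  have hE : ∀ᶠ n : ℕ in atTop, IsCopula
      (checkerboard ((n : ℝ) • rankMatrix (fun i => (U n i : ℝ)) (fun i => (V n i : ℝ)))) := by
    filter_upwards [eventually_gt_atTop 0] with n hn
    exact isCopula_checkerboard hn hn (isCheckerboardMatrix_rankMatrix (hU n) (hV n))
  have hN₁ := tendsto_floor_natCast_rpow hs₁.1
  have hN₂ := tendsto_floor_natCast_rpow hs₂
  simp only [he]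
  refine ⟨?_, fun u v => ?_⟩
  · filter_upwards [hE, hN₁.eventually_gt_atTop 0, hN₂.eventually_gt_atTop 0] with n hn h1 h2
    exact isCopula_checkerboard h1 h2 (hn.isCheckerboardMatrix h1 h2)
  · refine tendsto_siRearrangementFun_checkerboard C.2 hN₁ hN₂ hE ?_
      (tendsto_floor_rpow_mul_rate hs (by linarith)) u v
    filter_upwards [hω, eventually_gt_atTop 0] with n hn h0
    exact abs_checkerboard_rankMatrix_sub_le h0 (hU n) (hV n) C.2 hn

theorem mainTheorem7 {Ω : Type*} [MeasurableSpace Ω] (P : Measure Ω) [IsProbabilityMeasure P]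
    (μ : Copula → ℝ) (hμ : ContinuousOnStochasticallyIncreasing μ)
    (ρ : Measure (ℝ × ℝ)) [IsProbabilityMeasure ρ]
    (hρ : Continuous fun p : ℝ × ℝ => jointCdf ρ p.1 p.2)
    (C : Copula) (hC : IsCopulaOf C ρ)
    (X Y : ℕ → Ω → ℝ)
    (hlaw : ∀ i, HasLaw (fun ω => (X i ω, Y i ω)) ρ P)
    (hindep : iIndepFun (fun i ω => (X i ω, Y i ω)) P)
    (s₁ s₂ : ℝ) (hs₁ : s₁ ∈ Ioo (0 : ℝ) (1 / 2)) (hs₂ : s₂ ∈ Ioo (0 : ℝ) (1 / 2)) :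
    ∀ᵐ ω ∂P, Tendsto
      (fun n : ℕ => rearrangedEstimate μ ⌊(n : ℝ) ^ s₁⌋₊ ⌊(n : ℝ) ^ s₂⌋₊
        (fun i : Fin n => X i ω) (fun i : Fin n => Y i ω))
      atTop (𝓝 (rearrangedMeasure μ C)) := by
  classical
  filter_upwards [ae_tendsto_siRearrangementFun_empiricalCheckerboard hρ hC hlaw hindep hs₁ hs₂.1]
    with ω ⟨hcop, hlim⟩
  -- the finitely many estimates that may be undefined are replaced by the limit
  let D : ℕ → Copula := fun n =>
    if h : IsCopula (empiricalCheckerboard ⌊(n : ℝ) ^ s₁⌋₊ ⌊(n : ℝ) ^ s₂⌋₊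
      (fun i : Fin n => X i ω) (fun i : Fin n => Y i ω)) then siRearrangement ⟨_, h⟩
    else siRearrangement C
  have hD : Tendsto (fun n => μ (D n)) atTop (𝓝 (μ (siRearrangement C))) := by
    refine hμ D _ (fun n => ?_) (isStochasticallyIncreasing_siRearrangement C) fun u v => ?_
    · simp only [D]
      split_ifs <;> exact isStochasticallyIncreasing_siRearrangement _
    · refine (hlim u v).congr' ?_
      filter_upwards [hcop] with n hn
      simp only [D, dif_pos hn]
      rfl
  refine hD.congr' ?_
  filter_upwards [hcop] with n hn
  simp only [D, rearrangedEstimate, dif_pos hn, rearrangedMeasure]
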